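/- Let $p>1$ and let $(X,\mu)$ be a non-atomic probability space (every measurable set of positive measure has a measurable subset of strictly smaller positive measure). Let $\mathcal T$ be a tree on $X$, that is, a family of measurable subsets of $X$ such that: (i) $X\in\mathcal T$ and $\mu(I)>0$ for every $I\in\mathcal T$; (ii) to every $I\in\mathcal T$ there corresponds a finite or countable family $C(I)\subseteq\mathcal T$ with at least two elements, consisting of pairwise disjoint sets whose union is $I$; (iii) $\mathcal T=\bigcup_{m\ge0}\mathcal T_{(m)}$, where $\mathcal T_{(0)}=\{X\}$ and $\mathcal T_{(m+1)}=\bigcup_{I\in\mathcal T_{(m)}}C(I)$; (iv) $\lim_{m\to\infty}\sup_{I\in\mathcal T_{(m)}}\mu(I)=0$; (v) $\mathcal T$ differentiates $L^1(X,\mu)$: for every $g\in L^1(X,\mu)$ and $\mu$-almost every $x\in X$, $\frac1{\mu(I)}\int_I g\,d\mu\to g(x)$ as $\mu(I)\to0$ along the sets $I\in\mathcal T$ with $x\in I$. For $\phi\in L^1(X,\mu)$ put $$M_{\mathcal T}\phi(x)=\sup\Big\{\frac1{\mu(I)}\int_I|\phi|\,d\mu:\ x\in I\in\mathcal T\Big\}.$$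 **Theorem 1.3.** (a) Let $\beta\ge\gamma\ge0$ and let $K\subseteq X$ be measurable with $\mu(K)=k\in(0,1]$. For every $\phi\in L^p(X,\mu)$ with $\phi\ge0$ almost everywhere, $\int_X\phi\,d\mu=f$ and $\int_X\phi^p\,d\mu=F$, the integral $\int_X(M_{\mathcal T}\phi)^p\,d\mu$ is finite and $$F\ \ge\ \Big[1-\frac1{(1+\gamma)^{p-1}}\Big]\int_K\phi^p\,d\mu+\frac{(p-1)\beta}{(\beta+1)^p}\int_X(M_{\mathcal T}\phi)^p\,d\mu-\frac{(p-1)\gamma}{(\beta+1)^p}\int_K(M_{\mathcal T}\phi)^p\,d\mu+\frac{f^p}{(\beta+1)^{p-1}}.\qquad(*)$$ (b) The inequality is sharp in the following sense. Let $f,F$ be real numbers with $0<f^p\le F$, $f>0$. For each $k\in(0,1]$ there exist $\beta\ge\gamma\ge0$, a sequence $(K_n)$ of measurable subsets of $X$ with $\lim_n\mu(K_n)=k$, and a sequence $(\phi_n)$ of non-negative functions in $L^p(X,\mu)$ with $\int_X\phi_n\,d\mu=f$ and $\int_X\phi_n^p\,d\mu=F$ for all $n$, such that the right-hand side of $(*)$,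 with $\phi_n$ and $K_n$ in place of $\phi$ and $K$, converges to $F$ as $n\to\infty$. -/

import Mathlib

open MeasureTheory Filter
open scoped Topology ENNReal

/-- The measure `μ` is non-atomic: every measurable set of positive measure has a measurable
subset of strictly smaller positive measure. (Mathlib's `NoAtoms` only says that points are
null.) -/
def IsNonatomic {X : Type*} [MeasurableSpace X] (μ : Measure X) : Prop :=
  ∀ A : Set X, MeasurableSet A → 0 < μ A →
    ∃ B : Set X, B ⊆ A ∧ MeasurableSet B ∧ 0 < μ B ∧ μ B < μ A

/-- The `m`-th level of the family generated from the whole space by the children map `C`: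
level `0` is `{X}`, and level `m + 1` consists of the children of the sets of level `m`. -/
def treeLevel {X : Type*} (C : Set X → Set (Set X)) : ℕ → Set (Set X)
  | 0 => {Set.univ}
  | m + 1 => ⋃ I ∈ treeLevel C m, C I

/-- The set family `T` differentiates `L¹(X, μ)`: for every integrable `g` and almost every `x`,
the averages of `g` over `I` tend to `g x` as `μ I → 0` along the sets `I ∈ T` containing `x`. -/
def DifferentiatesL1 {X : Type*} [MeasurableSpace X] (μ : Measure X) (T : Set (Set X)) : Prop :=
  ∀ g : X → ℝ, Integrable g μ → ∀ᵐ x ∂μ,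
    Tendsto (fun I : Set X => (μ.real I)⁻¹ * ∫ y in I, g y ∂μ)
      (comap (fun I : Set X => μ I) (𝓝 0) ⊓ 𝓟 {I | I ∈ T ∧ x ∈ I}) (𝓝 (g x))

/-- `T` is a tree on `(X, μ)`, with children map `C`. -/
structure IsTreeWith {X : Type*} [MeasurableSpace X] (μ : Measure X) (T : Set (Set X))
    (C : Set X → Set (Set X)) : Prop where
  univ_mem : Set.univ ∈ T
  measurableSet : ∀ I ∈ T, MeasurableSet I
  measure_pos : ∀ I ∈ T, 0 < μ I
  children_subset : ∀ I ∈ T, C I ⊆ T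
  children_countable : ∀ I ∈ T, (C I).Countable
  children_nontrivial : ∀ I ∈ T, (C I).Nontrivial
  children_disjoint : ∀ I ∈ T, (C I).PairwiseDisjoint id
  sUnion_children : ∀ I ∈ T, ⋃₀ C I = I
  eq_iUnion_level : T = ⋃ m : ℕ, treeLevel C m
  tendsto_level : Tendsto (fun m : ℕ => ⨆ I ∈ treeLevel C m, μ I) atTop (𝓝 0)
  differentiates : DifferentiatesL1 μ T

/-- `T` is a tree on `(X, μ)`. -/
def IsTree {X : Type*} [MeasurableSpace X] (μ : Measure X) (T : Set (Set X)) : Prop :=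
  ∃ C : Set X → Set (Set X), IsTreeWith μ T C

/-- The dyadic maximal operator associated to `T`: the supremum of the averages of `|φ|` over
the sets of `T` that contain `x`, with values in `[0, ∞]`. -/
noncomputable def treeMaximal {X : Type*} [MeasurableSpace X] (μ : Measure X) (T : Set (Set X))
    (φ : X → ℝ) (x : X) : ℝ≥0∞ :=
  ⨆ (I : Set X) (_ : I ∈ T) (_ : x ∈ I), (∫⁻ y in I, ‖φ y‖ₑ ∂μ) / μ I

/-! Write M for the maximal function of φ. The set {M > t} is a disjoint union of maximal tree
members on which φ has average above t, so t μ{M > t} ≤ ∫_{M > t} φ. As M ≥ f everywhere,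
integrating this against p t^(p-2) over t ≥ f only gives (p-1)∫M^p + f^p ≤ p∫φM^(p-1)
(`integral_rpow_le_of_weakType`). Young's inequality p a b^(p-1) ≤ τ^(p-1) a^p + ((p-1)/τ) b^p, with
τ = β+1 off K and τ = (β+1)/(1+γ) on K, turns the right side into (*).

For sharpness, equality in Young means b = τa, so the aim is M = Sφ off K and M = sφ on K with S =
β+1 and s = (β+1)/(1+γ). Every tree member contains disjoint tree members filling any prescribed
proportion of it (`exists_subfamily`). Iterating with proportion 1-e gives decreasing sets E_j of
measure (1-e)^j; take K = E_m and φ constant on each layer E_j \ E_(j+1), with averages over the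
sets forming E_j equal to S times (j < m) or s times (j ≥ m) the layer value. All integrals are then
geometric sums.

When e → 0 and (1-e)^m → k, ∫φ^p / f^p tends to (1-w)/H(S) + w/H(s), where H is `layerProfile` and w
is the limit of `layerRatio p S e ^ m`. The numbers S and s are chosen to make this F/f^p
(`exists_phase_parameters`), and a small change of the factor on K makes ∫φ^p exactly F. Only lower
bounds for M are needed: the inequality itself bounds the right-hand side by F. -/

section Tree

/-! ### Trees: nesting of levels and maximal members of subfamilies. -/

variable {X : Type*}

/-- A children map whose generated levels consist of families of pairwise disjoint subsets. -/
structure IsNestedMap (C : Set X → Set (Set X)) : Prop where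
  subset : ∀ m, ∀ I ∈ treeLevel C m, ∀ J ∈ C I, J ⊆ I
  disjoint : ∀ m, ∀ I ∈ treeLevel C m, (C I).PairwiseDisjoint id

theorem mem_treeLevel_succ {C : Set X → Set (Set X)} {m : ℕ} {J : Set X} :
    J ∈ treeLevel C (m + 1) ↔ ∃ I ∈ treeLevel C m, J ∈ C I := by
  simp [treeLevel]

namespace IsNestedMap

variable {C : Set X → Set (Set X)}

theorem pairwiseDisjoint_level (h : IsNestedMap C) (m : ℕ) :
    (treeLevel C m).PairwiseDisjoint id := by
  induction m with
  | zero => simp [treeLevel]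
  | succ m ih =>
    intro J hJ J' hJ' hne
    obtain ⟨I, hI, hJI⟩ := mem_treeLevel_succ.1 hJ
    obtain ⟨I', hI', hJI'⟩ := mem_treeLevel_succ.1 hJ'
    by_cases hII : I = I'
    · subst hII
      exact h.disjoint m I hI hJI hJI' hne
    · exact (ih hI hI' hII).mono (h.subset m I hI J hJI) (h.subset m I' hI' J' hJI')

theorem exists_ancestor (h : IsNestedMap C) {m : ℕ} (d : ℕ) {J : Set X}
    (hJ : J ∈ treeLevel C (m + d)) : ∃ I ∈ treeLevel C m, J ⊆ I := by
  induction d generalizing J with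
  | zero => exact ⟨J, hJ, subset_rfl⟩
  | succ d ih =>
    obtain ⟨J', hJ', hJJ'⟩ := (mem_treeLevel_succ (m := m + d)).1 hJ
    obtain ⟨I, hI, hsub⟩ := ih hJ'
    exact ⟨I, hI, (h.subset _ J' hJ' J hJJ').trans hsub⟩

theorem antitone_sUnion_level (h : IsNestedMap C) : Antitone fun j => ⋃₀ treeLevel C j := by
  refine antitone_nat_of_succ_le fun j => ?_
  rintro x ⟨J, hJ, hx⟩
  obtain ⟨I, hI, hJI⟩ := mem_treeLevel_succ.1 hJ
  exact ⟨I, hI, h.subset j I hI J hJI hx⟩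

theorem subset_or_disjoint (h : IsNestedMap C) {m n : ℕ} (hmn : m ≤ n) {I J : Set X}
    (hI : I ∈ treeLevel C m) (hJ : J ∈ treeLevel C n) : J ⊆ I ∨ Disjoint J I := by
  obtain ⟨d, rfl⟩ := Nat.exists_eq_add_of_le hmn
  obtain ⟨I', hI', hsub⟩ := h.exists_ancestor d hJ
  by_cases hII : I' = I
  · exact Or.inl (hII ▸ hsub)
  · exact Or.inr ((h.pairwiseDisjoint_level m hI' hI hII).mono_left hsub)

end IsNestedMap

namespace IsTreeWith

variable [MeasurableSpace X] {μ : Measure X} {T : Set (Set X)} {C : Set X → Set (Set X)}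

theorem level_subset (h : IsTreeWith μ T C) (m : ℕ) : treeLevel C m ⊆ T := by
  rw [h.eq_iUnion_level]
  exact Set.subset_iUnion _ m

theorem exists_level (h : IsTreeWith μ T C) {I : Set X} (hI : I ∈ T) :
    ∃ m, I ∈ treeLevel C m := by
  rw [h.eq_iUnion_level] at hI
  exact Set.mem_iUnion.1 hI

theorem isNestedMap (h : IsTreeWith μ T C) : IsNestedMap C where
  subset m I hI J hJ := by
    rw [← h.sUnion_children I (h.level_subset m hI)]
    exact Set.subset_sUnion_of_mem hJ
  disjoint m I hI := h.children_disjoint I (h.level_subset m hI)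

theorem countable_level (h : IsTreeWith μ T C) (m : ℕ) : (treeLevel C m).Countable := by
  induction m with
  | zero => simp [treeLevel]
  | succ m ih => exact ih.biUnion fun I hI => h.children_countable I (h.level_subset m hI)

theorem countable (h : IsTreeWith μ T C) : T.Countable := by
  rw [h.eq_iUnion_level]
  exact Set.countable_iUnion h.countable_level

theorem exists_mem_level (h : IsTreeWith μ T C) (m : ℕ) (x : X) :
    ∃ I ∈ treeLevel C m, x ∈ I := by
  induction m with
  | zero => exact ⟨Set.univ, rfl, trivial⟩
  | succ m ih =>
    obtain ⟨I, hI, hx⟩ := ih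
    rw [← h.sUnion_children I (h.level_subset m hI)] at hx
    obtain ⟨J, hJ, hxJ⟩ := hx
    exact ⟨J, mem_treeLevel_succ.2 ⟨I, hI, hJ⟩, hxJ⟩

/-- Every member of a subfamily of the tree lies in a maximal member of the subfamily. -/
theorem exists_maximal (h : IsTreeWith μ T C) {S : Set (Set X)} (hS : S ⊆ T) {I : Set X}
    (hI : I ∈ S) : ∃ J ∈ {J | Maximal (· ∈ S) J}, I ⊆ J := by
  classical
  have hex : ∃ m, ∃ J ∈ treeLevel C m, J ∈ S ∧ I ⊆ J := by
    obtain ⟨m, hm⟩ := h.exists_level (hS hI)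
    exact ⟨m, I, hm, hI, subset_rfl⟩
  -- Choose J at the lowest possible level. A larger member of `S` cannot lie at a lower level, so
  -- by nesting it is contained in J or disjoint from it; the latter would make J empty, against
  -- positive measure.
  obtain ⟨J, hJ, hJS, hIJ⟩ := Nat.find_spec hex
  refine ⟨J, ⟨hJS, fun J' hJ' hJJ' => ?_⟩, hIJ⟩
  obtain ⟨n, hn⟩ := h.exists_level (hS hJ')
  have hle : Nat.find hex ≤ n := Nat.find_min' hex ⟨J', hn, hJ', hIJ.trans hJJ'⟩
  rcases h.isNestedMap.subset_or_disjoint hle hJ hn with h1 | h1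
  · exact h1
  · have hJe : J = ∅ := disjoint_self.1 (h1.mono_left hJJ')
    have := h.measure_pos J (hS hJS)
    simp [hJe] at this

theorem pairwiseDisjoint_maximal (h : IsTreeWith μ T C) {S : Set (Set X)} (hS : S ⊆ T) :
    {J | Maximal (· ∈ S) J}.PairwiseDisjoint id := by
  intro I hI J hJ hne
  obtain ⟨m, hm⟩ := h.exists_level (hS hI.1)
  obtain ⟨n, hn⟩ := h.exists_level (hS hJ.1)
  rcases le_total m n with hmn | hmn
  · rcases h.isNestedMap.subset_or_disjoint hmn hm hn with h1 | h1
    · exact absurd (subset_antisymm (hJ.2 hI.1 h1) h1) hne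
    · exact h1.symm
  · rcases h.isNestedMap.subset_or_disjoint hmn hn hm with h1 | h1
    · exact absurd (subset_antisymm h1 (hI.2 hJ.1 h1)) hne
    · exact h1

end IsTreeWith

/-! ### The maximal function and its weak type inequality. -/

section Maximal

variable [MeasurableSpace X] {μ : Measure X} {T : Set (Set X)} {C : Set X → Set (Set X)}

/-- Superlevel sets are unions of members of `T`; countability of a tree then gives measurability,
and maximal members give a disjoint decomposition. -/
theorem setOf_lt_treeMaximal (φ : X → ℝ) (a : ℝ≥0∞) :
    {x | a < treeMaximal μ T φ x} = ⋃₀ {I ∈ T | a < (∫⁻ y in I, ‖φ y‖ₑ ∂μ) / μ I} := by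
  ext x
  simp only [Set.mem_ofPred_eq, treeMaximal, lt_iSup_iff, Set.mem_sUnion]
  constructor
  · rintro ⟨I, hI, hx, hlt⟩
    exact ⟨I, ⟨hI, hlt⟩, hx⟩
  · rintro ⟨I, ⟨hI, hlt⟩, hx⟩
    exact ⟨I, hI, hx, hlt⟩

theorem le_treeMaximal {I : Set X} (hI : I ∈ T) {x : X} (hx : x ∈ I) (φ : X → ℝ) :
    (∫⁻ y in I, ‖φ y‖ₑ ∂μ) / μ I ≤ treeMaximal μ T φ x :=
  le_iSup_of_le I (le_iSup_of_le hI (le_iSup_of_le hx le_rfl))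

theorem measurableSet_lt_treeMaximal (h : IsTreeWith μ T C) (φ : X → ℝ) (a : ℝ≥0∞) :
    MeasurableSet {x | a < treeMaximal μ T φ x} := by
  rw [setOf_lt_treeMaximal]
  exact MeasurableSet.sUnion (h.countable.mono (Set.sep_subset _ _))
    fun I hI => h.measurableSet I hI.1

theorem measurable_treeMaximal (h : IsTreeWith μ T C) (φ : X → ℝ) :
    Measurable (treeMaximal μ T φ) :=
  measurable_of_Ioi fun a => measurableSet_lt_treeMaximal h φ a

/-- The weak type inequality for the tree maximal operator. -/
theorem mul_measure_lt_treeMaximal_le (h : IsTreeWith μ T C) (φ : X → ℝ) (a : ℝ≥0∞) :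
    a * μ {x | a < treeMaximal μ T φ x} ≤
      ∫⁻ x in {x | a < treeMaximal μ T φ x}, ‖φ x‖ₑ ∂μ := by
  rw [setOf_lt_treeMaximal]
  set S := {I ∈ T | a < (∫⁻ y in I, ‖φ y‖ₑ ∂μ) / μ I} with hSdef
  have hS : S ⊆ T := Set.sep_subset _ _
  -- The maximal members are disjoint and have the same union, so the estimate, which is the
  -- definition of `S` on each of them, can be summed.
  set S' := {J | Maximal (· ∈ S) J}
  have hS'S : S' ⊆ S := fun J hJ => hJ.1
  have hU : ⋃₀ S = ⋃ J ∈ S', id J := by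
    ext x
    simp only [Set.mem_sUnion, Set.mem_iUnion, exists_prop, id]
    constructor
    · rintro ⟨I, hI, hx⟩
      obtain ⟨J, hJ, hIJ⟩ := h.exists_maximal hS hI
      exact ⟨J, hJ, hIJ hx⟩
    · rintro ⟨J, hJ, hx⟩
      exact ⟨J, hS'S hJ, hx⟩
  have hc : S'.Countable := h.countable.mono (hS'S.trans hS)
  have hm : ∀ J ∈ S', MeasurableSet J := fun J hJ => h.measurableSet J (hS (hS'S hJ))
  have hd := h.pairwiseDisjoint_maximal hS
  rw [hU, measure_biUnion hc hd hm, lintegral_biUnion (s := id) hc hm hd, ← ENNReal.tsum_mul_left]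
  refine ENNReal.tsum_le_tsum fun J => ?_
  have hJ := (hS'S J.2).2
  exact ENNReal.mul_le_of_le_div hJ.le

end Maximal

end Tree

/-! ### Young's inequality and integration of the weak type inequality. -/

/-- Young's inequality with a parameter. -/
theorem mul_rpow_sub_one_le {p a b t : ℝ} (hp : 1 < p) (ha : 0 ≤ a) (hb : 0 ≤ b) (ht : 0 < t) :
    p * (a * b ^ (p - 1)) ≤ t ^ (p - 1) * a ^ p + (p - 1) / t * b ^ p := by
  have hp0 : 0 < p := by linarith
  -- The powers of t are placed so that they cancel in the geometric mean.
  have h := Real.geom_mean_le_arith_mean2_weighted (w₁ := 1 / p) (w₂ := (p - 1) / p)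
    (p₁ := t ^ (p - 1) * a ^ p) (p₂ := b ^ p / t) (by positivity)
    (div_nonneg (by linarith) hp0.le) (by positivity) (by positivity) (by field_simp; ring)
  have h1 : (t ^ (p - 1) * a ^ p) ^ (1 / p) = t ^ ((p - 1) / p) * a := by
    rw [Real.mul_rpow (by positivity) (by positivity), ← Real.rpow_mul ht.le,
      ← Real.rpow_mul ha, mul_one_div_cancel hp0.ne', Real.rpow_one, mul_one_div]
  have h2 : (b ^ p / t) ^ ((p - 1) / p) = b ^ (p - 1) / t ^ ((p - 1) / p) := by
    rw [Real.div_rpow (by positivity) ht.le, ← Real.rpow_mul hb, mul_div_cancel₀ _ hp0.ne']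
  rw [h1, h2] at h
  have h3 : t ^ ((p - 1) / p) * a * (b ^ (p - 1) / t ^ ((p - 1) / p)) = a * b ^ (p - 1) := by
    have : 0 < t ^ ((p - 1) / p) := by positivity
    field_simp
  rw [h3] at h
  calc p * (a * b ^ (p - 1)) ≤ p * (1 / p * (t ^ (p - 1) * a ^ p) + (p - 1) / p * (b ^ p / t)) := by
        gcongr
    _ = _ := by field_simp

theorem intervalIntegral_mul_add_rpow {q c x : ℝ} (hq : 0 < q) :
    ∫ t in (0 : ℝ)..x, q * (t + c) ^ (q - 1) = (x + c) ^ q - c ^ q := by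
  rw [intervalIntegral.integral_const_mul,
    intervalIntegral.integral_comp_add_right (fun t => t ^ (q - 1)),
    integral_rpow (Or.inl (by linarith))]
  simp only [sub_add_cancel, zero_add]
  field_simp

section

variable {X : Type*} [MeasurableSpace X]

/-- The layer cake formula for `g - c`. Starting at height c instead of 0 retains the constant c ^
q, the source of the f ^ p term in the final inequality. -/
theorem lintegral_rpow_sub_rpow_eq (ν : Measure X) {g : X → ℝ} {c q : ℝ} (hg : Measurable g)
    (hc : 0 < c) (hq : 0 < q) (hcg : ∀ x, c ≤ g x) :
    ∫⁻ x, ENNReal.ofReal (g x ^ q - c ^ q) ∂ν =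
      ∫⁻ t in Set.Ioi (0 : ℝ), ν {x | t + c < g x} * ENNReal.ofReal (q * (t + c) ^ (q - 1)) := by
  have hcont : ContinuousOn (fun t : ℝ => q * (t + c) ^ (q - 1)) (Set.Ici 0) := by
    refine continuousOn_const.mul (ContinuousOn.rpow_const (by fun_prop) fun t ht => Or.inl ?_)
    have : (0 : ℝ) ≤ t := ht
    positivity
  have h := lintegral_comp_eq_lintegral_meas_lt_mul (f := fun x => g x - c)
    (g := fun t => q * (t + c) ^ (q - 1)) ν
    (Eventually.of_forall fun x => sub_nonneg.2 (hcg x)) (hg.sub_const c).aemeasurable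
    (fun t ht => (hcont.mono (by
      rw [Set.uIcc_of_le ht.le]; exact Set.Icc_subset_Ici_self)).intervalIntegrable)
    ((ae_restrict_iff' measurableSet_Ioi).2 (Eventually.of_forall fun t ht => by
      have : (0 : ℝ) < t := ht
      positivity))
  simp only [lt_sub_iff_add_lt] at h
  rw [← h]
  refine lintegral_congr fun x => ?_
  rw [intervalIntegral_mul_add_rpow hq, sub_add_cancel]

/-- Integration of a weak type inequality against powers: the form with a pointwise lower
bound `c`. -/
theorem integral_rpow_le_of_weakType (μ : Measure X) [IsProbabilityMeasure μ] {φ g : X → ℝ}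
    {c N p : ℝ} (hp : 1 < p) (hφ : Integrable φ μ) (hφ0 : 0 ≤ᵐ[μ] φ) (hg : Measurable g)
    (hc : 0 < c) (hcg : ∀ x, c ≤ g x) (hgN : ∀ x, g x ≤ N)
    (hweak : ∀ t, c ≤ t → ENNReal.ofReal t * μ {x | t < g x} ≤
      ∫⁻ x in {x | t < g x}, ENNReal.ofReal (φ x) ∂μ) :
    (p - 1) * ∫ x, g x ^ p ∂μ + c ^ (p - 1) * (p * ∫ x, φ x ∂μ - (p - 1) * c) ≤
      p * ∫ x, φ x * g x ^ (p - 1) ∂μ := by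
  have hp1 : 0 < p - 1 := by linarith
  have hp0 : 0 < p := by linarith
  have hg0 : ∀ x, 0 < g x := fun x => hc.trans_le (hcg x)
  set w : X → ℝ≥0∞ := fun x => ENNReal.ofReal (φ x) with hw
  have hwm : AEMeasurable w μ := hφ.aemeasurable.ennreal_ofReal
  -- Both sides are layer cakes, for μ and for φ·μ. At height t + c one factor t + c of p(t +
  -- c)^(p-1) is spent on the weak type bound; the rest is p/(p-1) times the density for exponent
  -- p-1.
  have key : ∫⁻ x, ENNReal.ofReal (g x ^ p - c ^ p) ∂μ ≤
      ENNReal.ofReal (p / (p - 1)) *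
        ∫⁻ x, ENNReal.ofReal (g x ^ (p - 1) - c ^ (p - 1)) ∂(μ.withDensity w) := by
    rw [lintegral_rpow_sub_rpow_eq μ hg hc hp0 hcg, lintegral_rpow_sub_rpow_eq _ hg hc hp1 hcg,
      ← lintegral_const_mul' _ _ ENNReal.ofReal_ne_top]
    refine setLIntegral_mono_ae' measurableSet_Ioi (Eventually.of_forall fun t ht => ?_)
    have ht : (0 : ℝ) < t := ht
    have htc : 0 < t + c := by positivity
    have hm : MeasurableSet {x | t + c < g x} := measurableSet_lt measurable_const hg
    rw [withDensity_apply _ hm]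
    have h1 : ENNReal.ofReal (p * (t + c) ^ (p - 1)) =
        ENNReal.ofReal (t + c) * ENNReal.ofReal (p * (t + c) ^ (p - 1 - 1)) := by
      rw [← ENNReal.ofReal_mul htc.le]
      congr 1
      rw [Real.rpow_sub_one htc.ne' (p - 1)]
      field_simp
    have h2 : ENNReal.ofReal (p * (t + c) ^ (p - 1 - 1)) =
        ENNReal.ofReal (p / (p - 1)) * ENNReal.ofReal ((p - 1) * (t + c) ^ (p - 1 - 1)) := by
      rw [← ENNReal.ofReal_mul (by positivity)]
      congr 1
      field_simp
    calc μ {x | t + c < g x} * ENNReal.ofReal (p * (t + c) ^ (p - 1))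
        = (ENNReal.ofReal (t + c) * μ {x | t + c < g x}) *
            ENNReal.ofReal (p * (t + c) ^ (p - 1 - 1)) := by rw [h1]; ring
      _ ≤ (∫⁻ x in {x | t + c < g x}, w x ∂μ) * ENNReal.ofReal (p * (t + c) ^ (p - 1 - 1)) := by
          gcongr
          exact hweak _ (by linarith)
      _ = _ := by rw [h2]; ring
  have hbq : ∀ q : ℝ, 0 < q → ∀ x, ‖g x ^ q‖ ≤ N ^ q := fun q hq x => by
    rw [Real.norm_of_nonneg (Real.rpow_nonneg (hg0 x).le _)]
    exact Real.rpow_le_rpow (hg0 x).le (hgN x) hq.le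
  have hgp : Integrable (fun x => g x ^ p) μ :=
    Integrable.of_bound (hg.pow_const p).aestronglyMeasurable (N ^ p)
      (Eventually.of_forall (hbq p hp0))
  have hgφ : Integrable (fun x => φ x * g x ^ (p - 1)) μ :=
    hφ.mul_bdd (c := N ^ (p - 1)) (hg.pow_const _).aestronglyMeasurable
      (Eventually.of_forall (hbq (p - 1) hp1))
  have hgφ' : Integrable (fun x => φ x * (g x ^ (p - 1) - c ^ (p - 1))) μ := by
    simp only [mul_sub]
    exact hgφ.sub (hφ.mul_const _)
  have hnn : ∀ q : ℝ, 0 < q → ∀ x, 0 ≤ g x ^ q - c ^ q := fun q hq x =>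
    sub_nonneg.2 (Real.rpow_le_rpow hc.le (hcg x) hq.le)
  rw [lintegral_withDensity_eq_lintegral_mul₀ hwm
    ((hg.pow_const _).sub_const _).ennreal_ofReal.aemeasurable] at key
  have hr : ∫⁻ x, (w * fun x => ENNReal.ofReal (g x ^ (p - 1) - c ^ (p - 1))) x ∂μ =
      ENNReal.ofReal (∫ x, φ x * (g x ^ (p - 1) - c ^ (p - 1)) ∂μ) := by
    rw [ofReal_integral_eq_lintegral_ofReal hgφ' (by
      filter_upwards [hφ0] with x hx
      exact mul_nonneg hx (hnn _ hp1 x))]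
    refine lintegral_congr_ae ?_
    filter_upwards [hφ0] with x hx
    simp only [Pi.mul_apply, hw]
    rw [ENNReal.ofReal_mul hx]
  have hgp' : Integrable (fun x => g x ^ p - c ^ p) μ := hgp.sub (integrable_const _)
  rw [hr, ← ofReal_integral_eq_lintegral_ofReal hgp'
    (Eventually.of_forall (hnn p hp0)), ← ENNReal.ofReal_mul (by positivity),
    ENNReal.ofReal_le_ofReal_iff (mul_nonneg (by positivity) (integral_nonneg_of_ae (by
      filter_upwards [hφ0] with x hx
      exact mul_nonneg hx (hnn _ hp1 x))))] at key
  simp only [mul_sub] at key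
  rw [integral_sub hgp (integrable_const _), integral_sub hgφ (hφ.mul_const _),
    integral_mul_const] at key
  simp only [integral_const, probReal_univ, one_smul] at key
  have hcp : c ^ p = c ^ (p - 1) * c := by
    rw [Real.rpow_sub_one hc.ne']; field_simp
  rw [hcp, div_mul_eq_mul_div, le_div_iff₀ hp1] at key
  linarith

end

/-! ### The inequality: first for truncations, then in the limit. -/

section

variable {X : Type*} [MeasurableSpace X] {μ : Measure X}

/-- Young with parameter (β+1)/(1+γ) on K and β+1 on the complement, divided by (β+1)^(p-1): then
∫_K φ^p carries 1/(1+γ)^(p-1), and what remains of ∫g^p has coefficient (p-1)(β-γ)/(β+1)^p on K and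
(p-1)β/(β+1)^p off K. -/
theorem sharp_inequality_of_integral_le {φ g : X → ℝ} {p β γ c : ℝ} (hp : 1 < p)
    (hβ : 0 ≤ β) (hγ : 0 ≤ γ) {K : Set X} (hK : MeasurableSet K)
    (hφ0 : 0 ≤ᵐ[μ] φ) (hg0 : ∀ x, 0 ≤ g x)
    (hφp : Integrable (fun x => φ x ^ p) μ) (hgp : Integrable (fun x => g x ^ p) μ)
    (hφg : Integrable (fun x => φ x * g x ^ (p - 1)) μ)
    (h : (p - 1) * ∫ x, g x ^ p ∂μ + c ≤ p * ∫ x, φ x * g x ^ (p - 1) ∂μ) :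
    (1 - 1 / (1 + γ) ^ (p - 1)) * (∫ x in K, φ x ^ p ∂μ)
      + (p - 1) * β / (β + 1) ^ p * (∫ x, g x ^ p ∂μ)
      - (p - 1) * γ / (β + 1) ^ p * (∫ x in K, g x ^ p ∂μ)
      + c / (β + 1) ^ (p - 1) ≤ ∫ x, φ x ^ p ∂μ := by
  have young : ∀ (t : ℝ), 0 < t → ∀ S : Set X, MeasurableSet S →
      p * ∫ x in S, φ x * g x ^ (p - 1) ∂μ ≤
        t ^ (p - 1) * (∫ x in S, φ x ^ p ∂μ) + (p - 1) / t * ∫ x in S, g x ^ p ∂μ := by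
    intro t ht S hS
    rw [← integral_const_mul, ← integral_const_mul, ← integral_const_mul,
      ← integral_add (hφp.integrableOn.const_mul _) (hgp.integrableOn.const_mul _)]
    refine integral_mono_ae (hφg.integrableOn.const_mul _)
      ((hφp.integrableOn.const_mul _).add (hgp.integrableOn.const_mul _)) ?_
    filter_upwards [ae_restrict_of_ae hφ0] with x hx
    exact mul_rpow_sub_one_le hp hx (hg0 x) ht
  have hb : 0 < β + 1 := by linarith
  have hc : 0 < 1 + γ := by linarith
  have h1 := young ((β + 1) / (1 + γ)) (by positivity) K hK
  have h2 := young (β + 1) hb Kᶜ hK.compl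
  rw [← integral_add_compl hK hφg, ← integral_add_compl hK hgp] at h
  rw [← integral_add_compl hK hφp, ← integral_add_compl hK hgp]
  rw [Real.div_rpow hb.le hc.le] at h1
  set A := ∫ x in K, φ x ^ p ∂μ
  set A' := ∫ x in Kᶜ, φ x ^ p ∂μ
  set G := ∫ x in K, g x ^ p ∂μ
  set G' := ∫ x in Kᶜ, g x ^ p ∂μ
  have hbp : (β + 1) ^ p = (β + 1) ^ (p - 1) * (β + 1) := by
    rw [Real.rpow_sub_one hb.ne']; field_simp
  have hB : 0 < (β + 1) ^ (p - 1) := by positivity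
  have hC : 0 < (1 + γ) ^ (p - 1) := by positivity
  rw [hbp]
  set B := (β + 1) ^ (p - 1)
  set D := (1 + γ) ^ (p - 1)
  have key : (p - 1) * (G + G') + c ≤ B / D * A + (p - 1) / ((β + 1) / (1 + γ)) * G +
      (B * A' + (p - 1) / (β + 1) * G') := by linarith
  have key2 := div_le_div_of_nonneg_right key hB.le
  have e1 : (B / D * A + (p - 1) / ((β + 1) / (1 + γ)) * G + (B * A' + (p - 1) / (β + 1) * G')) / B
      = A / D + (p - 1) * (1 + γ) / (B * (β + 1)) * G + A' + (p - 1) / (B * (β + 1)) * G' := by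
    field_simp
    ring
  have e2 : ((p - 1) * (G + G') + c) / B = (p - 1) * (β + 1) / (B * (β + 1)) * (G + G') + c / B := by
    field_simp
  rw [e1, e2] at key2
  have e3 : (p - 1) * (β + 1) / (B * (β + 1)) = (p - 1) * β / (B * (β + 1)) +
      (p - 1) / (B * (β + 1)) := by ring
  have e4 : (p - 1) * (1 + γ) / (B * (β + 1)) = (p - 1) * γ / (B * (β + 1)) +
      (p - 1) / (B * (β + 1)) := by ring
  rw [e3, e4] at key2
  have e5 : A / D = 1 / D * A := by ring
  rw [e5] at key2
  linarith

variable {T : Set (Set X)} {C : Set X → Set (Set X)}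

/-- The maximal function truncated at height `N`. -/
noncomputable def truncatedMaximal (μ : Measure X) (T : Set (Set X)) (φ : X → ℝ) (N : ℝ)
    (x : X) : ℝ :=
  (min (treeMaximal μ T φ x) (ENNReal.ofReal N)).toReal

theorem measurable_truncatedMaximal (h : IsTreeWith μ T C) (φ : X → ℝ) (N : ℝ) :
    Measurable (truncatedMaximal μ T φ N) :=
  ((measurable_treeMaximal h φ).min measurable_const).ennreal_toReal

theorem ofReal_truncatedMaximal_rpow (φ : X → ℝ) (N : ℝ) {p : ℝ} (hp : 0 ≤ p) (x : X) :
    ENNReal.ofReal (truncatedMaximal μ T φ N x ^ p) =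
      min (treeMaximal μ T φ x) (ENNReal.ofReal N) ^ p := by
  rw [truncatedMaximal, ← ENNReal.ofReal_rpow_of_nonneg ENNReal.toReal_nonneg hp,
    ENNReal.ofReal_toReal (ne_top_of_le_ne_top ENNReal.ofReal_ne_top (min_le_right _ _))]

theorem lt_truncatedMaximal_iff (φ : X → ℝ) {N t : ℝ} (ht : 0 ≤ t) (x : X) :
    t < truncatedMaximal μ T φ N x ↔ ENNReal.ofReal t < treeMaximal μ T φ x ∧ t < N := by
  rw [truncatedMaximal, ← ENNReal.ofReal_lt_iff_lt_toReal ht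
    (ne_top_of_le_ne_top ENNReal.ofReal_ne_top (min_le_right _ _)), lt_min_iff,
    ENNReal.ofReal_lt_ofReal_iff_of_nonneg ht]

theorem lintegral_enorm_eq_ofReal_integral {φ : X → ℝ} (hφ : Integrable φ μ) (hφ0 : 0 ≤ᵐ[μ] φ) :
    ∫⁻ x, ‖φ x‖ₑ ∂μ = ENNReal.ofReal (∫ x, φ x ∂μ) := by
  rw [ofReal_integral_eq_lintegral_ofReal hφ hφ0]
  refine lintegral_congr_ae ?_
  filter_upwards [hφ0] with x hx
  exact Real.enorm_eq_ofReal hx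

theorem tendsto_lintegral_truncatedMaximal (h : IsTreeWith μ T C) (φ : X → ℝ) {p : ℝ}
    (hp : 0 ≤ p) (K : Set X) :
    Tendsto (fun N : ℕ => ∫⁻ x in K, ENNReal.ofReal (truncatedMaximal μ T φ N x ^ p) ∂μ) atTop
      (𝓝 (∫⁻ x in K, treeMaximal μ T φ x ^ p ∂μ)) := by
  simp only [ofReal_truncatedMaximal_rpow φ _ hp]
  refine lintegral_tendsto_of_tendsto_of_monotone
    (fun N => (((measurable_treeMaximal h φ).min measurable_const).pow_const p).aemeasurable)
    (Eventually.of_forall fun x => ?_) (Eventually.of_forall fun x => ?_)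
  · intro m n hmn
    have : (m : ℝ) ≤ n := by exact_mod_cast hmn
    dsimp only
    gcongr
  · refine (ENNReal.continuous_rpow_const.tendsto _).comp ?_
    have h1 : Tendsto (fun N : ℕ => ENNReal.ofReal (N : ℝ)) atTop (𝓝 ∞) := by
      simpa using ENNReal.tendsto_nat_nhds_top
    simpa using (tendsto_const_nhds (x := treeMaximal μ T φ x)).min h1

variable [IsProbabilityMeasure μ]

theorem ofReal_integral_le_treeMaximal (h : IsTreeWith μ T C) {φ : X → ℝ}
    (hφ : Integrable φ μ) (hφ0 : 0 ≤ᵐ[μ] φ) (x : X) :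
    ENNReal.ofReal (∫ x, φ x ∂μ) ≤ treeMaximal μ T φ x := by
  simpa [lintegral_enorm_eq_ofReal_integral hφ hφ0] using
    le_treeMaximal (μ := μ) h.univ_mem (Set.mem_univ x) φ

theorem integrable_truncatedMaximal_rpow (h : IsTreeWith μ T C) (φ : X → ℝ) {N p : ℝ}
    (hN : 0 ≤ N) (hp : 0 ≤ p) : Integrable (fun x => truncatedMaximal μ T φ N x ^ p) μ := by
  refine Integrable.of_bound
    ((measurable_truncatedMaximal h φ N).pow_const p).aestronglyMeasurable (N ^ p)
    (Eventually.of_forall fun x => ?_)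
  have h0 : 0 ≤ truncatedMaximal μ T φ N x := ENNReal.toReal_nonneg
  rw [Real.norm_of_nonneg (Real.rpow_nonneg h0 _)]
  exact Real.rpow_le_rpow h0
    (ENNReal.toReal_le_of_le_ofReal hN (min_le_right _ _)) hp

/-- Truncation keeps all integrals finite before the maximal function is known to be in L^p. It
preserves the weak type bound, because superlevel sets are unchanged below N and empty from N on,
and it preserves the lower bound f, because the whole space is in the tree and f ≤ N. -/
theorem sharp_inequality_truncated (h : IsTreeWith μ T C) {φ : X → ℝ} {p β γ N : ℝ} (hp : 1 < p)
    (hβ : 0 ≤ β) (hγ : 0 ≤ γ) {K : Set X} (hK : MeasurableSet K)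
    (hφ : MemLp φ (ENNReal.ofReal p) μ) (hφ0 : 0 ≤ᵐ[μ] φ) (hf : 0 < ∫ x, φ x ∂μ)
    (hN : ∫ x, φ x ∂μ ≤ N) :
    (1 - 1 / (1 + γ) ^ (p - 1)) * (∫ x in K, φ x ^ p ∂μ)
      + (p - 1) * β / (β + 1) ^ p * (∫ x, truncatedMaximal μ T φ N x ^ p ∂μ)
      - (p - 1) * γ / (β + 1) ^ p * (∫ x in K, truncatedMaximal μ T φ N x ^ p ∂μ)
      + (∫ x, φ x ∂μ) ^ p / (β + 1) ^ (p - 1) ≤ ∫ x, φ x ^ p ∂μ := by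
  have hp0 : 0 < p := by linarith
  have hint : Integrable φ μ := hφ.integrable (by simpa using hp.le)
  have hN0 : 0 ≤ N := hf.le.trans hN
  have hφp : Integrable (fun x => φ x ^ p) μ := by
    have := hφ.integrable_norm_rpow (by simpa using hp0) ENNReal.ofReal_ne_top
    rw [ENNReal.toReal_ofReal hp0.le] at this
    refine this.congr ?_
    filter_upwards [hφ0] with x hx
    rw [Real.norm_of_nonneg hx]
  have hgm := measurable_truncatedMaximal h φ N
  have hgN : ∀ x, truncatedMaximal μ T φ N x ≤ N := fun x =>
    ENNReal.toReal_le_of_le_ofReal hN0 (min_le_right _ _)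
  have hg0 : ∀ x, 0 ≤ truncatedMaximal μ T φ N x := fun x => ENNReal.toReal_nonneg
  refine sharp_inequality_of_integral_le hp hβ hγ hK hφ0 hg0 hφp
    (integrable_truncatedMaximal_rpow h φ hN0 hp0.le) ?_ ?_
  · refine hint.mul_bdd (c := N ^ (p - 1)) (hgm.pow_const _).aestronglyMeasurable
      (Eventually.of_forall fun x => ?_)
    rw [Real.norm_of_nonneg (Real.rpow_nonneg (hg0 x) _)]
    exact Real.rpow_le_rpow (hg0 x) (hgN x) (by linarith)
  · have := integral_rpow_le_of_weakType μ hp hint hφ0 hgm hf (fun x => ?_) hgN ?_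
    · have e : (∫ x, φ x ∂μ) ^ p = (∫ x, φ x ∂μ) ^ (p - 1) *
          (p * ∫ x, φ x ∂μ - (p - 1) * ∫ x, φ x ∂μ) := by
        rw [Real.rpow_sub_one hf.ne']; field_simp; ring
      rwa [e]
    · rw [truncatedMaximal, ← ENNReal.ofReal_le_iff_le_toReal
        (ne_top_of_le_ne_top ENNReal.ofReal_ne_top (min_le_right _ _)), le_min_iff]
      exact ⟨ofReal_integral_le_treeMaximal h hint hφ0 x, ENNReal.ofReal_le_ofReal hN⟩
    · intro t ht
      have ht0 : 0 ≤ t := hf.le.trans ht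
      simp only [lt_truncatedMaximal_iff φ ht0]
      by_cases htN : t < N
      · simp only [htN, and_true]
        refine (mul_measure_lt_treeMaximal_le h φ _).trans_eq (lintegral_congr_ae ?_)
        filter_upwards [ae_restrict_of_ae hφ0] with x hx
        exact Real.enorm_eq_ofReal hx
      · simp [htN]

theorem lintegral_treeMaximal_rpow_lt_top_and_sharp_inequality (h : IsTreeWith μ T C)
    {φ : X → ℝ} {p : ℝ} (hp : 1 < p) (hφ : MemLp φ (ENNReal.ofReal p) μ) (hφ0 : 0 ≤ᵐ[μ] φ) :
    ∫⁻ x, treeMaximal μ T φ x ^ p ∂μ < ∞ ∧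
    ∀ β γ : ℝ, 0 ≤ β → 0 ≤ γ → ∀ K : Set X, MeasurableSet K →
      (1 - 1 / (1 + γ) ^ (p - 1)) * (∫ x in K, φ x ^ p ∂μ)
        + (p - 1) * β / (β + 1) ^ p * (∫⁻ x, treeMaximal μ T φ x ^ p ∂μ).toReal
        - (p - 1) * γ / (β + 1) ^ p * (∫⁻ x in K, treeMaximal μ T φ x ^ p ∂μ).toReal
        + (∫ x, φ x ∂μ) ^ p / (β + 1) ^ (p - 1) ≤ ∫ x, φ x ^ p ∂μ := by
  have hp0 : 0 < p := by linarith
  have hint : Integrable φ μ := hφ.integrable (by simpa using hp.le)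
  -- The layer cake needs a positive starting height f; for f = 0 the function vanishes almost
  -- everywhere and every term is 0.
  rcases (integral_nonneg_of_ae hφ0).eq_or_lt with hf | hf
  · have hz : φ =ᵐ[μ] 0 := (integral_eq_zero_iff_of_nonneg_ae hφ0 hint).1 hf.symm
    have hM : ∀ x, treeMaximal μ T φ x = 0 := fun x => by
      have : ∀ I, ∫⁻ y in I, ‖φ y‖ₑ ∂μ = 0 := fun I => by
        rw [lintegral_congr_ae (g := 0)]
        · simp
        · filter_upwards [ae_restrict_of_ae hz] with x hx
          simp [hx]
      simp [treeMaximal, this]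
    have hφz : ∀ K : Set X, ∫ x in K, φ x ^ p ∂μ = 0 := fun K => by
      rw [integral_congr_ae (g := 0)]
      · simp
      · filter_upwards [ae_restrict_of_ae hz] with x hx
        simp [hx, hp0.ne']
    have hφz' : ∫ x, φ x ^ p ∂μ = 0 := by simpa using hφz Set.univ
    refine ⟨by simp [hM, hp0], fun β γ hβ hγ K hK => ?_⟩
    rw [hφz, hφz', ← hf]
    simp [hM, hp0, hp0.ne']
  · have hev : ∀ᶠ N : ℕ in atTop, ∫ x, φ x ∂μ ≤ N :=
      (tendsto_natCast_atTop_atTop (R := ℝ)).eventually_ge_atTop _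
    have htr := tendsto_lintegral_truncatedMaximal h φ hp0.le
    have heq : ∀ N : ℕ, ∀ K : Set X,
        ∫⁻ x in K, ENNReal.ofReal (truncatedMaximal μ T φ N x ^ p) ∂μ =
        ENNReal.ofReal (∫ x in K, truncatedMaximal μ T φ N x ^ p ∂μ) := fun N K =>
      (ofReal_integral_eq_lintegral_ofReal
        (integrable_truncatedMaximal_rpow h φ N.cast_nonneg hp0.le).integrableOn
        (Eventually.of_forall fun x => Real.rpow_nonneg ENNReal.toReal_nonneg _)).symm
    have hfin : ∫⁻ x, treeMaximal μ T φ x ^ p ∂μ < ∞ := by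
      have htr1 := htr Set.univ
      simp only [Measure.restrict_univ] at htr1
      refine (le_of_tendsto htr1 (b := ENNReal.ofReal
        ((∫ x, φ x ^ p ∂μ) / ((p - 1) / 2 ^ p))) ?_).trans_lt ENNReal.ofReal_lt_top
      filter_upwards [hev] with N hN
      -- With γ = 0 both terms over K vanish, and β = 1 leaves the positive coefficient (p-1)/2^p: a
      -- bound uniform in N. Finiteness then permits the limit in the subtracted term as well.
      have := sharp_inequality_truncated h (β := 1) (γ := 0) hp zero_le_one le_rfl
        MeasurableSet.univ hφ hφ0 hf hN
      have heq' := heq N Set.univ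
      simp only [Measure.restrict_univ] at heq'
      rw [heq']
      refine ENNReal.ofReal_le_ofReal ?_
      rw [le_div_iff₀ (div_pos (by linarith) (by positivity))]
      have hpos : 0 ≤ (∫ x, φ x ∂μ) ^ p / (1 + 1 : ℝ) ^ (p - 1) := by positivity
      norm_num at this hpos
      linarith
    have htr2 : ∀ K : Set X, Tendsto
        (fun N : ℕ => ∫ x in K, truncatedMaximal μ T φ N x ^ p ∂μ) atTop
        (𝓝 (∫⁻ x in K, treeMaximal μ T φ x ^ p ∂μ).toReal) := fun K => by
      have hK : ∫⁻ x in K, treeMaximal μ T φ x ^ p ∂μ ≠ ∞ :=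
        ((setLIntegral_le_lintegral _ _).trans_lt hfin).ne
      refine ((ENNReal.tendsto_toReal hK).comp (htr K)).congr fun N => ?_
      rw [Function.comp_apply, heq, ENNReal.toReal_ofReal]
      exact integral_nonneg fun x => Real.rpow_nonneg ENNReal.toReal_nonneg _
    refine ⟨hfin, fun β γ hβ hγ K hK => ?_⟩
    have htrU := htr2 Set.univ
    simp only [Measure.restrict_univ] at htrU
    refine le_of_tendsto ((((htrU.const_mul _).const_add _).sub
      ((htr2 K).const_mul _)).add_const _) ?_
    filter_upwards [hev] with N hN
    exact sharp_inequality_truncated h hp hβ hγ hK hφ hφ0 hf hN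

end

/-! ### Disjoint tree members of prescribed total measure. -/

/-- Among finitely many numbers in `[0, δ]` one can select some whose sum is within `δ` below a
given target not exceeding the total sum. -/
theorem exists_subset_sum_near {ι : Type*} [DecidableEq ι] (s : Finset ι)
    (m : ι → ℝ) {δ t : ℝ} (ht : 0 ≤ t) (hδ0 : 0 ≤ δ) (hm : ∀ i, 0 ≤ m i)
    (hδ : ∀ i ∈ s, m i ≤ δ) :
    ∃ s' ⊆ s, ∑ i ∈ s', m i ≤ t ∧ min t (∑ i ∈ s, m i) - δ ≤ ∑ i ∈ s', m i := by
  induction s using Finset.induction_on with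
  | empty => exact ⟨∅, subset_rfl, by simpa, by simp [ht, hδ0]⟩
  | insert a s ha ih =>
    obtain ⟨s', hs', h1, h2⟩ := ih fun i hi => hδ i (Finset.mem_insert_of_mem hi)
    have ha' : a ∉ s' := fun h => ha (hs' h)
    have hma := hδ a (Finset.mem_insert_self a s)
    -- Greedy choice: if `a` no longer fits, the sum is already within m a ≤ δ of t.
    by_cases h : m a + ∑ i ∈ s', m i ≤ t
    · refine ⟨insert a s', Finset.insert_subset_insert a hs', ?_, ?_⟩
      · rwa [Finset.sum_insert ha']
      · rw [Finset.sum_insert ha', Finset.sum_insert ha]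
        rcases le_total t (∑ i ∈ s, m i) with h3 | h3
        · rw [min_eq_left h3] at h2
          linarith [min_le_left t (m a + ∑ i ∈ s, m i), hm a]
        · rw [min_eq_right h3] at h2
          linarith [min_le_right t (m a + ∑ i ∈ s, m i)]
    · refine ⟨s', hs'.trans (Finset.subset_insert a s), h1, ?_⟩
      linarith [min_le_left t (∑ i ∈ insert a s, m i)]

section

variable {X : Type*} [MeasurableSpace X] {μ : Measure X} {T : Set (Set X)}
  {C : Set X → Set (Set X)}

/-- A finite family of pairwise disjoint members of `T` inside `I`. -/
structure IsPacking (T : Set (Set X)) (I : Set X) (S : Finset (Set X)) : Prop where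
  mem : ∀ J ∈ S, J ∈ T
  subset : ∀ J ∈ S, J ⊆ I
  disjoint : (S : Set (Set X)).PairwiseDisjoint id

namespace IsTreeWith

theorem eventually_level_measureReal_le (h : IsTreeWith μ T C) {ε : ℝ} (hε : 0 < ε) :
    ∀ᶠ n in atTop, ∀ J ∈ treeLevel C n, μ.real J ≤ ε := by
  have := h.tendsto_level.eventually_le_const (u := ENNReal.ofReal ε) (by simpa)
  filter_upwards [this] with n hn J hJ
  refine ENNReal.toReal_le_of_le_ofReal hε.le (le_trans ?_ hn)
  exact le_iSup₂_of_le J hJ le_rfl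

variable [IsFiniteMeasure μ]

theorem measureReal_biUnion_packing (h : IsTreeWith μ T C) {I : Set X} {S : Finset (Set X)}
    (hS : IsPacking T I S) : μ.real (⋃ J ∈ S, J) = ∑ J ∈ S, μ.real J :=
  measureReal_biUnion_finset (f := id) hS.disjoint fun J hJ => h.measurableSet J (hS.mem J hJ)

/-- Since `S` is finite, some level n is at least as deep as I and all members of `S` and has
members of measure at most ε/2. The members of that level inside I and disjoint from `S` tile
exactly the rest of I. One ε/2 is lost in reducing to finitely many of them, the other in the greedy
selection. -/
theorem exists_packing_extension (h : IsTreeWith μ T C) {I : Set X} (hI : I ∈ T)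
    {S : Finset (Set X)} (hS : IsPacking T I S) {t ε : ℝ} (hSt : ∑ J ∈ S, μ.real J ≤ t)
    (htI : t ≤ μ.real I) (hε : 0 < ε) :
    ∃ S', S ⊆ S' ∧ IsPacking T I S' ∧ ∑ J ∈ S', μ.real J ≤ t ∧ t - ε ≤ ∑ J ∈ S', μ.real J := by
  classical
  obtain ⟨l, hl⟩ := h.exists_level hI
  have hlev : ∀ᶠ n in atTop, ∀ J ∈ S, ∃ m ≤ n, J ∈ treeLevel C m := by
    refine (Filter.eventually_all_finset S).2 fun J hJ => ?_
    obtain ⟨m, hm⟩ := h.exists_level (hS.mem J hJ)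
    filter_upwards [eventually_ge_atTop m] with n hn
    exact ⟨m, hn, hm⟩
  obtain ⟨n, hln, hn, hnε⟩ := ((eventually_ge_atTop l).and
    (hlev.and (h.eventually_level_measureReal_le (half_pos hε)))).exists
  set D : Set (Set X) := {J ∈ treeLevel C n | J ⊆ I ∧ ∀ J' ∈ S, Disjoint J J'} with hD
  have hDn : D ⊆ treeLevel C n := Set.sep_subset _ _
  have hDT : D ⊆ T := hDn.trans (h.level_subset n)
  have hDU : ⋃₀ D = I \ ⋃ J ∈ S, J := by
    ext x
    constructor
    · rintro ⟨J, ⟨-, hJI, hJS⟩, hx⟩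
      refine ⟨hJI hx, fun hxS => ?_⟩
      obtain ⟨J', hJ', hx'⟩ := Set.mem_iUnion₂.1 hxS
      exact Set.disjoint_left.1 (hJS J' hJ') hx hx'
    · rintro ⟨hxI, hxS⟩
      obtain ⟨J, hJ, hxJ⟩ := h.exists_mem_level n x
      refine ⟨J, ⟨hJ, ?_, fun J' hJ' => ?_⟩, hxJ⟩
      · exact (h.isNestedMap.subset_or_disjoint hln hl hJ).resolve_right
          fun hd => Set.disjoint_left.1 hd hxJ hxI
      · obtain ⟨m, hmn, hm⟩ := hn J' hJ'
        exact (h.isNestedMap.subset_or_disjoint hmn hm hJ).resolve_left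
          fun hsub => hxS (Set.mem_iUnion₂.2 ⟨J', hJ', hsub hxJ⟩)
  have hDd : D.PairwiseDisjoint id := (h.isNestedMap.pairwiseDisjoint_level n).subset hDn
  have hDc : D.Countable := h.countable.mono hDT
  have hDm : ∀ J ∈ D, MeasurableSet J := fun J hJ => h.measurableSet J (hDT hJ)
  have hsum : HasSum (fun J : D => μ.real (J : Set X)) (μ.real (⋃₀ D)) := by
    have he : μ (⋃₀ D) = ∑' J : D, μ (J : Set X) := measure_sUnion hDc hDd hDm
    rw [measureReal_def, he, ENNReal.tsum_toReal_eq fun J => measure_ne_top μ _]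
    exact ENNReal.hasSum_toReal (he ▸ measure_ne_top μ _)
  have hSm : MeasurableSet (⋃ J ∈ S, J) :=
    S.measurableSet_biUnion fun J hJ => h.measurableSet J (hS.mem J hJ)
  rw [hDU, measureReal_sdiff (Set.iUnion₂_subset hS.subset) hSm,
    h.measureReal_biUnion_packing hS] at hsum
  obtain ⟨s, hs⟩ := (hsum.eventually (lt_mem_nhds (b := μ.real I - ∑ J ∈ S, μ.real J)
    (a := μ.real I - ∑ J ∈ S, μ.real J - ε / 2) (by linarith))).exists
  obtain ⟨s', -, h1, h2⟩ := exists_subset_sum_near s (fun J : D => μ.real (J : Set X))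
    (t := t - ∑ J ∈ S, μ.real J) (sub_nonneg.2 hSt) (half_pos hε).le
    (fun _ => measureReal_nonneg) (fun J _ => hnε J (hDn J.2))
  set s'' : Finset (Set X) := s'.map (Function.Embedding.subtype _)
  have hs''D : ∀ J ∈ s'', J ∈ D := by
    intro J hJ
    obtain ⟨J', -, rfl⟩ := Finset.mem_map.1 hJ
    exact J'.2
  have hsum'' : ∑ J ∈ s'', μ.real J = ∑ J ∈ s', μ.real (J : Set X) := Finset.sum_map _ _ _
  have hdis : Disjoint S s'' := by
    rw [Finset.disjoint_left]
    intro J hJ hJ''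
    have hJe : J = ∅ := disjoint_self.1 ((hs''D J hJ'').2.2 J hJ)
    have := h.measure_pos J (hS.mem J hJ)
    simp [hJe] at this
  refine ⟨S ∪ s'', Finset.subset_union_left, ⟨?_, ?_, ?_⟩, ?_, ?_⟩
  · intro J hJ
    exact (Finset.mem_union.1 hJ).elim (hS.mem J) fun hJ => hDT (hs''D J hJ)
  · intro J hJ
    exact (Finset.mem_union.1 hJ).elim (hS.subset J) fun hJ => (hs''D J hJ).2.1
  · rw [Finset.coe_union, Set.pairwiseDisjoint_union]
    refine ⟨hS.disjoint, hDd.subset hs''D, fun J hJ J' hJ' _ => ?_⟩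
    exact ((hs''D J' hJ').2.2 J hJ).symm
  · rw [Finset.sum_union hdis, hsum'']
    linarith
  · rw [Finset.sum_union hdis, hsum'']
    have : t - ∑ J ∈ S, μ.real J - ε / 2 ≤
        min (t - ∑ J ∈ S, μ.real J) (∑ J ∈ s, μ.real (J : Set X)) :=
      le_min (by linarith) (by linarith)
    linarith

/-- Every member of the tree contains disjoint members of the tree of prescribed total measure. -/
theorem exists_subfamily (h : IsTreeWith μ T C) {I : Set X} (hI : I ∈ T) {t : ℝ} (ht : 0 ≤ t)
    (htI : t ≤ μ.real I) :
    ∃ S ⊆ T, (∀ J ∈ S, J ⊆ I) ∧ S.PairwiseDisjoint id ∧ μ.real (⋃₀ S) = t := by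
  let P := {S : Finset (Set X) // IsPacking T I S ∧ ∑ J ∈ S, μ.real J ≤ t}
  have hstep : ∀ (n : ℕ) (S : P), ∃ S' : P, S.1 ⊆ S'.1 ∧
      t - 1 / ((n : ℝ) + 1) ≤ ∑ J ∈ S'.1, μ.real J := fun n S => by
    obtain ⟨S', h1, h2, h3, h4⟩ := h.exists_packing_extension hI S.2.1 S.2.2 htI
      (ε := 1 / ((n : ℝ) + 1)) (by positivity)
    exact ⟨⟨S', h2, h3⟩, h1, h4⟩
  choose next hnext1 hnext2 using hstep
  -- Increasing finite packings: stage n + 1 misses the target by at most 1/(n+1), so the union has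
  -- measure exactly t.
  let S : ℕ → P := fun n => Nat.rec ⟨∅, ⟨by simp, by simp, by simp⟩, by simpa⟩ next n
  have hmono : Monotone fun n => (S n).1 := monotone_nat_of_le_succ fun n => hnext1 n (S n)
  have hlim : Tendsto (fun n => ∑ J ∈ (S n).1, μ.real J) atTop (𝓝 t) := by
    rw [← tendsto_add_atTop_iff_nat 1]
    refine tendsto_of_tendsto_of_tendsto_of_le_of_le (g := fun n : ℕ => t - 1 / ((n : ℝ) + 1))
      (h := fun _ => t) ?_ tendsto_const_nhds (fun n => hnext2 n (S n)) (fun n => (S (n + 1)).2.2)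
    simpa using tendsto_const_nhds.sub (tendsto_one_div_add_atTop_nhds_zero_nat (𝕜 := ℝ))
  refine ⟨⋃ n, ((S n).1 : Set (Set X)), ?_, ?_, ?_, ?_⟩
  · exact Set.iUnion_subset fun n J hJ => (S n).2.1.mem J hJ
  · intro J hJ
    obtain ⟨n, hn⟩ := Set.mem_iUnion.1 hJ
    exact (S n).2.1.subset J hn
  · exact (Set.pairwiseDisjoint_iUnion (directed_of_isDirected_le fun m n hmn =>
      Finset.coe_subset.2 (hmono hmn))).2 fun n => (S n).2.1.disjoint
  · have hU : ⋃₀ (⋃ n, ((S n).1 : Set (Set X))) = ⋃ n, ⋃ J ∈ (S n).1, J := by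
      ext x
      simp only [Set.mem_sUnion, Set.mem_iUnion, Finset.mem_coe, exists_prop]
      exact ⟨fun ⟨J, ⟨n, hn⟩, hx⟩ => ⟨n, J, hn, hx⟩, fun ⟨n, J, hn, hx⟩ => ⟨J, ⟨n, hn⟩, hx⟩⟩
    have hmono' : Monotone fun n => ⋃ J ∈ (S n).1, J := fun m n hmn =>
      Set.biUnion_subset_biUnion_left (hmono hmn)
    have h1 := (ENNReal.tendsto_toReal (measure_ne_top μ _)).comp
      (tendsto_measure_iUnion_atTop (μ := μ) hmono')
    rw [hU]
    refine tendsto_nhds_unique h1 (hlim.congr fun n => ?_)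
    exact (h.measureReal_biUnion_packing (S n).2.1).symm

end IsTreeWith

end

/-! ### Functions constant on layers of geometrically decreasing measure. -/

/-- The value of `c` on the layers of a decreasing sequence of sets. -/
noncomputable def layerFun {X : Type*} (E : ℕ → Set X) (c : ℕ → ℝ) (x : X) : ℝ :=
  (∑' j, (E j \ E (j + 1)).indicator (fun _ => ENNReal.ofReal (c j)) x).toReal

theorem layerFun_eq {X : Type*} {E : ℕ → Set X} (hanti : Antitone E) {c : ℕ → ℝ} (hc : ∀ j, 0 ≤ c j) {j : ℕ}
    {x : X} (hx : x ∈ E j \ E (j + 1)) : layerFun E c x = c j := by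
  rw [layerFun, tsum_eq_single j, Set.indicator_of_mem hx, ENNReal.toReal_ofReal (hc j)]
  intro i hij
  refine Set.indicator_of_notMem (fun hxi => ?_) _
  rcases lt_or_gt_of_ne hij with hlt | hlt
  · exact hxi.2 (hanti hlt hx.1)
  · exact hx.2 (hanti hlt hxi.1)

section

variable {X : Type*} [MeasurableSpace X] {μ : Measure X} {T : Set (Set X)}
  {C : Set X → Set (Set X)}

/-- A function constant on the layers `E j \ E (j + 1)` of a decreasing sequence of sets is
integrated layer by layer. -/
theorem integral_of_eq_on_layers (ν : Measure X) [IsFiniteMeasure ν] {E : ℕ → Set X} {g : X → ℝ}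
    {b : ℕ → ℝ} {s : ℝ} (hE : ∀ j, MeasurableSet (E j)) (hanti : Antitone E)
    (hcov : ∀ᵐ x ∂ν, ∃ j, x ∈ E j \ E (j + 1)) (hg : Measurable g) (hg0 : ∀ x, 0 ≤ g x)
    (hb : ∀ j, 0 ≤ b j) (hgb : ∀ j, ∀ x ∈ E j \ E (j + 1), g x = b j)
    (hs : HasSum (fun j => ν.real (E j \ E (j + 1)) * b j) s) :
    Integrable g ν ∧ ∫ x, g x ∂ν = s := by
  have hterm : ∀ j, 0 ≤ ν.real (E j \ E (j + 1)) * b j := fun j =>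
    mul_nonneg measureReal_nonneg (hb j)
  have hD : ∀ j, MeasurableSet (E j \ E (j + 1)) := fun j => (hE j).diff (hE _)
  have hdisj : Pairwise (Function.onFun Disjoint fun j => E j \ E (j + 1)) := by
    intro i j hij
    wlog hlt : i < j generalizing i j
    · exact (this hij.symm (lt_of_le_of_ne (not_lt.1 hlt) hij.symm)).symm
    · exact Set.disjoint_left.2 fun x hx hx' => hx.2 (hanti hlt hx'.1)
  have hl : ∫⁻ x, ENNReal.ofReal (g x) ∂ν = ENNReal.ofReal s := by
    have hae : ν.restrict (⋃ j, E j \ E (j + 1)) = ν := by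
      refine Measure.restrict_eq_self_of_ae_mem ?_
      filter_upwards [hcov] with x hx
      exact Set.mem_iUnion.2 hx
    calc ∫⁻ x, ENNReal.ofReal (g x) ∂ν
        = ∫⁻ x in ⋃ j, E j \ E (j + 1), ENNReal.ofReal (g x) ∂ν := by rw [hae]
      _ = ∑' j, ∫⁻ x in E j \ E (j + 1), ENNReal.ofReal (g x) ∂ν :=
          lintegral_iUnion hD hdisj _
      _ = ∑' j, ENNReal.ofReal (ν.real (E j \ E (j + 1)) * b j) := by
          refine tsum_congr fun j => ?_
          rw [setLIntegral_congr_fun (g := fun _ => ENNReal.ofReal (b j)) (hD j)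
            (fun x hx => by simp only [hgb j x hx]), setLIntegral_const,
            ENNReal.ofReal_mul measureReal_nonneg, ofReal_measureReal, mul_comm]
      _ = ENNReal.ofReal s := by rw [← ENNReal.ofReal_tsum_of_nonneg hterm hs.summable, hs.tsum_eq]
  constructor
  · refine ⟨hg.aestronglyMeasurable, ?_⟩
    rw [hasFiniteIntegral_iff_ofReal (Eventually.of_forall hg0), hl]
    exact ENNReal.ofReal_lt_top
  · rw [integral_eq_lintegral_of_nonneg_ae (Eventually.of_forall hg0) hg.aestronglyMeasurable, hl,
      ENNReal.toReal_ofReal (hs.nonneg hterm)]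

/-- The case of layers whose measure decreases geometrically. -/
theorem setIntegral_of_eq_on_geometric_layers [IsFiniteMeasure μ] {E : ℕ → Set X} {g : X → ℝ}
    {b : ℕ → ℝ} {r s : ℝ} {A : Set X} {j : ℕ} (hE : ∀ j, MeasurableSet (E j)) (hanti : Antitone E)
    (hcov : ∀ᵐ x ∂μ, ∃ j, x ∈ E j \ E (j + 1)) (hg : Measurable g) (hg0 : ∀ x, 0 ≤ g x)
    (hb : ∀ j, 0 ≤ b j) (hgb : ∀ j, ∀ x ∈ E j \ E (j + 1), g x = b j)
    (hAE : A ⊆ E j) (hAr : ∀ d, μ.real (A ∩ E (j + d)) = r ^ d * μ.real A)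
    (hs : HasSum (fun d => (1 - r) * r ^ d * b (j + d)) s) :
    IntegrableOn g A μ ∧ ∫ x in A, g x ∂μ = s * μ.real A := by
  refine integral_of_eq_on_layers (μ.restrict A) hE hanti (ae_restrict_of_ae hcov) hg hg0 hb hgb ?_
  have hmeas : ∀ i, (μ.restrict A).real (E i \ E (i + 1)) =
      μ.real (A ∩ E i) - μ.real (A ∩ E (i + 1)) := fun i => by
    have hsub : A ∩ E i ∩ E (i + 1) = A ∩ E (i + 1) := by
      rw [Set.inter_assoc, Set.inter_eq_right.2 (hanti i.le_succ)]
    have h1 := measureReal_inter_add_sdiff (μ := μ) (s := A ∩ E i) (hE (i + 1))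
    rw [measureReal_restrict_apply ((hE i).diff (hE _)), Set.inter_comm, ← Set.inter_sdiff_assoc]
    rw [hsub] at h1
    linarith
  simp only [hmeas]
  -- As A lies in E j, the layers before j do not meet A, and the sum may be reindexed by j + d.
  rw [← (add_right_injective j).hasSum_iff]
  · refine (congrArg (HasSum · _) (funext fun d => ?_)).mp (hs.mul_right (μ.real A))
    rw [Function.comp_apply, hAr, add_assoc, hAr, pow_succ]
    ring
  · intro i hi
    have hij : i + 1 ≤ j := by
      by_contra hcon
      exact hi ⟨i - j, by simp only; omega⟩
    rw [Set.inter_eq_left.2 (hAE.trans (hanti hij)),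
      Set.inter_eq_left.2 (hAE.trans (hanti (by omega : i ≤ j))), sub_self, zero_mul]

namespace IsNestedMap

variable {R : Set X → Set (Set X)}

/-- If each member of each level is filled up to the proportion `r` by its children, then it is
filled up to the proportion `r ^ d` by its descendants of generation `d`. -/
theorem measureReal_inter_sUnion_level [IsFiniteMeasure μ] (h : IsNestedMap R) {r : ℝ}
    (hm : ∀ j, ∀ I ∈ treeLevel R j, MeasurableSet I) (hc : ∀ j, (treeLevel R j).Countable)
    (hr : ∀ j, ∀ I ∈ treeLevel R j, μ.real (⋃₀ R I) = r * μ.real I) (d : ℕ) :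
    ∀ j, ∀ I ∈ treeLevel R j, μ.real (I ∩ ⋃₀ treeLevel R (j + d)) = r ^ d * μ.real I := by
  induction d with
  | zero =>
    intro j I hI
    rw [Set.inter_eq_left.2 (Set.subset_sUnion_of_mem (by simpa using hI))]
    simp
  | succ d ih =>
    intro j I hI
    have hRI : R I ⊆ treeLevel R (j + 1) := fun J hJ => mem_treeLevel_succ.2 ⟨I, hI, hJ⟩
    have hRc : (R I).Countable := (hc (j + 1)).mono hRI
    have hRd := h.disjoint j I hI
    have hEm : ∀ i, MeasurableSet (⋃₀ treeLevel R i) := fun i =>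
      MeasurableSet.sUnion (hc i) (hm i)
    -- By disjointness of level j, a point of I that survives to level j + 1 lies in a child of I,
    -- so the induction hypothesis applies child by child.
    have hset : I ∩ ⋃₀ treeLevel R (j + (d + 1)) =
        ⋃ J ∈ R I, J ∩ ⋃₀ treeLevel R (j + 1 + d) := by
      rw [show j + (d + 1) = j + 1 + d by omega]
      ext x
      simp only [Set.mem_inter_iff, Set.mem_iUnion₂, exists_prop]
      constructor
      · rintro ⟨hxI, hx⟩
        obtain ⟨J, hJ, hxJ⟩ := h.antitone_sUnion_level (Nat.le_add_right (j + 1) d) hx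
        obtain ⟨I', hI', hJI'⟩ := mem_treeLevel_succ.1 hJ
        have : I' = I := by
          by_contra hne
          exact Set.disjoint_left.1 (h.pairwiseDisjoint_level j hI' hI hne)
            (h.subset j I' hI' J hJI' hxJ) hxI
        exact ⟨J, this ▸ hJI', hxJ, hx⟩
      · rintro ⟨J, hJ, hxJ, hx⟩
        exact ⟨h.subset j I hI J hJ hxJ, hx⟩
    have h1 : μ (I ∩ ⋃₀ treeLevel R (j + (d + 1))) =
        ∑' J : R I, μ ((J : Set X) ∩ ⋃₀ treeLevel R (j + 1 + d)) := by
      rw [hset]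
      exact measure_biUnion hRc (hRd.mono fun J => Set.inter_subset_left)
        fun J hJ => (hm _ J (hRI hJ)).inter (hEm _)
    have h2 : μ (⋃₀ R I) = ∑' J : R I, μ (J : Set X) :=
      measure_sUnion hRc hRd fun J hJ => hm _ J (hRI hJ)
    have h3 := hr j I hI
    rw [measureReal_def, h2, ENNReal.tsum_toReal_eq fun J => measure_ne_top μ _] at h3
    rw [measureReal_def, h1, ENNReal.tsum_toReal_eq fun J => measure_ne_top μ _, pow_succ,
      mul_assoc, ← h3, ← tsum_mul_left]
    exact tsum_congr fun J => ih (j + 1) J (hRI J.2)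

end IsNestedMap

/-- The series defining `layerFun` is summed in [0, ∞], so no summability is required. -/
theorem measurable_layerFun {E : ℕ → Set X} (hE : ∀ j, MeasurableSet (E j)) (c : ℕ → ℝ) :
    Measurable (layerFun E c) :=
  (Measurable.tsum fun j =>
    measurable_const.indicator ((hE j).diff (hE (j + 1)))).ennreal_toReal

/-- A function on a tree which is constant on layers of geometrically decreasing measure, with
the corresponding lower bound for its maximal function. -/
theorem IsTreeWith.exists_layered_function [IsProbabilityMeasure μ] (h : IsTreeWith μ T C)
    {p r : ℝ} (hp : 0 < p) (hr0 : 0 ≤ r) (hr1 : r < 1) {c y : ℕ → ℝ} (hc : ∀ j, 0 ≤ c j)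
    (hy : ∀ j, HasSum (fun d => (1 - r) * r ^ d * c (j + d)) (y j))
    (hcp : Summable fun j => (1 - r) * r ^ j * c j ^ p) :
    ∃ (E : ℕ → Set X) (φ : X → ℝ), (∀ j, MeasurableSet (E j)) ∧ E 0 = Set.univ ∧ Antitone E ∧
      (∀ j, μ.real (E j) = r ^ j) ∧ (∀ᵐ x ∂μ, ∃ j, x ∈ E j \ E (j + 1)) ∧
      (∀ x, 0 ≤ φ x) ∧ (∀ j, ∀ x ∈ E j \ E (j + 1), φ x = c j) ∧
      MemLp φ (ENNReal.ofReal p) μ ∧ ∫ x, φ x ∂μ = y 0 ∧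
      (∀ m s, HasSum (fun d => (1 - r) * r ^ d * c (m + d) ^ p) s →
        ∫ x in E m, φ x ^ p ∂μ = s * r ^ m) ∧
      ∀ j, ∀ x ∈ E j, ENNReal.ofReal (y j) ≤ treeMaximal μ T φ x := by
  have hsel : ∀ I, ∃ S ⊆ T, (∀ J ∈ S, J ⊆ I) ∧ S.PairwiseDisjoint id ∧
      (I ∈ T → μ.real (⋃₀ S) = r * μ.real I) := fun I => by
    by_cases hI : I ∈ T
    · obtain ⟨S, h1, h2, h3, h4⟩ := h.exists_subfamily hI
        (mul_nonneg hr0 (measureReal_nonneg (μ := μ) (s := I)))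
        (mul_le_of_le_one_left measureReal_nonneg hr1.le)
      exact ⟨S, h1, h2, h3, fun _ => h4⟩
    · exact ⟨∅, Set.empty_subset _, by simp, by simp, fun hI' => absurd hI' hI⟩
  -- `R` serves as a new children map, whose levels consist of members of `T` but skip generations
  -- of the tree and no longer cover the space.
  choose R hRT hRsub hRd hRr using hsel
  have hR : IsNestedMap R := ⟨fun _ I _ => hRsub I, fun _ I _ => hRd I⟩
  have hlev : ∀ j, treeLevel R j ⊆ T := fun j => by
    cases j with
    | zero => simpa [treeLevel] using h.univ_mem
    | succ j =>
      intro J hJ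
      obtain ⟨I, -, hJI⟩ := mem_treeLevel_succ.1 hJ
      exact hRT I hJI
  have hlm : ∀ j, ∀ I ∈ treeLevel R j, MeasurableSet I := fun j I hI =>
    h.measurableSet I (hlev j hI)
  have hlc : ∀ j, (treeLevel R j).Countable := fun j => h.countable.mono (hlev j)
  set E : ℕ → Set X := fun j => ⋃₀ treeLevel R j with hEdef
  have hE : ∀ j, MeasurableSet (E j) := fun j => MeasurableSet.sUnion (hlc j) (hlm j)
  have hE0 : E 0 = Set.univ := by simp [hEdef, treeLevel]
  have hanti : Antitone E := hR.antitone_sUnion_level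
  have hinter := fun d => hR.measureReal_inter_sUnion_level (μ := μ) hlm hlc
    (fun j I hI => hRr I (hlev j hI)) d
  have hEr : ∀ j, μ.real (E j) = r ^ j := fun j => by
    have := hinter j 0 Set.univ rfl
    simpa using this
  have hcov : ∀ᵐ x ∂μ, ∃ j, x ∈ E j \ E (j + 1) := by
    have hnull : μ (⋂ j, E j) = 0 := by
      have h1 : μ.real (⋂ j, E j) ≤ 0 :=
        ge_of_tendsto' (tendsto_pow_atTop_nhds_zero_of_lt_one hr0 hr1) fun j => by
          rw [← hEr j]
          exact measureReal_mono (Set.iInter_subset _ j)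
      exact (measureReal_eq_zero_iff (measure_ne_top _ _)).1 (h1.antisymm measureReal_nonneg)
    have hae : ∀ᵐ x ∂μ, x ∉ ⋂ j, E j := measure_eq_zero_iff_ae_notMem.1 hnull
    filter_upwards [hae] with x hx
    by_contra hcon
    push Not at hcon
    refine hx (Set.mem_iInter.2 fun j => ?_)
    induction j with
    | zero => simp [hE0]
    | succ j ih => exact by_contra fun hx' => hcon j ⟨ih, hx'⟩
  set φ := layerFun E c with hφdef
  have hφm : Measurable φ := measurable_layerFun hE c
  have hφ0 : ∀ x, 0 ≤ φ x := fun x => ENNReal.toReal_nonneg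
  have hφc : ∀ j, ∀ x ∈ E j \ E (j + 1), φ x = c j := fun j x hx => layerFun_eq hanti hc hx
  -- Self-similarity: all sets I of level j carry the same average y j, and as I ∈ T this average
  -- bounds the maximal function from below on I.
  have hint1 : ∀ j, ∀ I ∈ treeLevel R j, IntegrableOn φ I μ ∧ ∫ x in I, φ x ∂μ = y j * μ.real I :=
    fun j I hI => setIntegral_of_eq_on_geometric_layers hE hanti hcov hφm hφ0 hc hφc
      (Set.subset_sUnion_of_mem hI) (fun d => hinter d j I hI) (hy j)
  have hintp : ∀ m s, HasSum (fun d => (1 - r) * r ^ d * c (m + d) ^ p) s →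
      IntegrableOn (fun x => φ x ^ p) (E m) μ ∧ ∫ x in E m, φ x ^ p ∂μ = s * r ^ m := by
    intro m s hs
    rw [← hEr m]
    refine setIntegral_of_eq_on_geometric_layers (b := fun j => c j ^ p) hE hanti hcov
      (hφm.pow_const p) (fun x => Real.rpow_nonneg (hφ0 x) p) (fun j => Real.rpow_nonneg (hc j) p)
      (fun j x hx => by rw [hφc j x hx]) subset_rfl (fun d => ?_) hs
    rw [Set.inter_eq_right.2 (hanti (Nat.le_add_right m d)), hEr, hEr, pow_add, mul_comm]
  have hpE0 := (hintp 0 _ (by simpa using hcp.hasSum)).1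
  rw [hE0, integrableOn_univ] at hpE0
  refine ⟨E, φ, hE, hE0, hanti, hEr, hcov, hφ0, hφc, ?_, ?_, fun m s hs => (hintp m s hs).2, ?_⟩
  · rw [← integrable_norm_rpow_iff hφm.aestronglyMeasurable (by simpa using hp)
      ENNReal.ofReal_ne_top, ENNReal.toReal_ofReal hp.le]
    simpa only [Real.norm_of_nonneg (hφ0 _)] using hpE0
  · simpa using (hint1 0 Set.univ rfl).2
  · rintro j x ⟨I, hI, hx⟩
    refine le_trans (le_of_eq ?_) (le_treeMaximal (hlev j hI) hx φ)
    obtain ⟨h1, h2⟩ := hint1 j I hI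
    rw [lintegral_enorm_eq_ofReal_integral h1 (Eventually.of_forall hφ0), h2,
      ENNReal.ofReal_mul' measureReal_nonneg, ofReal_measureReal,
      ENNReal.mul_div_cancel_right (h.measure_pos I (hlev j hI)).ne' (measure_ne_top _ _)]

end

theorem integrable_rpow_of_memLp {X : Type*} [MeasurableSpace X] {μ : Measure X} {φ : X → ℝ}
    {p : ℝ} (hp : 0 < p) (hφ0 : ∀ x, 0 ≤ φ x) (hφ : MemLp φ (ENNReal.ofReal p) μ) :
    Integrable (fun x => φ x ^ p) μ := by
  have := hφ.integrable_norm_rpow (by simpa using hp) ENNReal.ofReal_ne_top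
  simpa only [ENNReal.toReal_ofReal hp.le, Real.norm_of_nonneg (hφ0 _)] using this

/-! ### Two-phase functions. -/

/-- The factor by which the `p`-th power sums over layers change from one layer to the next, if
the averages are `τ` times the values and each layer takes up the proportion `e`. -/
noncomputable def layerRatio (p τ e : ℝ) : ℝ := (1 - e / τ) ^ p * (1 - e) ^ (1 - p)

/-- From one layer to the next the measure shrinks by 1 - e and the values grow by (1 - e/τ)/(1 -
e). -/
theorem layerRatio_eq {p τ e : ℝ} (he1 : e < 1) (hτ : 1 ≤ τ) :
    layerRatio p τ e = (1 - e) * ((1 - e / τ) / (1 - e)) ^ p := by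
  have h1 : 0 < 1 - e := by linarith
  have h2 : 0 ≤ 1 - e / τ := by
    rw [sub_nonneg, div_le_one (by linarith)]
    linarith
  rw [layerRatio, Real.div_rpow h2 h1.le, Real.rpow_sub h1, Real.rpow_one]
  field_simp

theorem layerRatio_pos {p τ e : ℝ} (he0 : 0 ≤ e) (he1 : e < 1) (hτ : 1 ≤ τ) :
    0 < layerRatio p τ e := by
  have h2 : e / τ ≤ e := div_le_self he0 hτ
  exact mul_pos (Real.rpow_pos_of_pos (by linarith) _) (Real.rpow_pos_of_pos (by linarith) _)

/-- The recursion splits the average y j into the value c j on the share 1 - r and the average y (j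
+ 1) on the share r. Partial sums telescope, with remainder r^n y (j + n). -/
theorem hasSum_of_telescoping {r : ℝ} (hr0 : 0 < r) (hr1 : r ≤ 1) {c y : ℕ → ℝ} (hc : ∀ j, 0 ≤ c j)
    (h : ∀ j, (1 - r) * c j = y j - r * y (j + 1))
    (hlim : Tendsto (fun n => r ^ n * y n) atTop (𝓝 0)) (j : ℕ) :
    HasSum (fun d => (1 - r) * r ^ d * c (j + d)) (y j) := by
  have hpos : 0 ≤ 1 - r := by linarith
  rw [hasSum_iff_tendsto_nat_of_nonneg fun d =>
    mul_nonneg (mul_nonneg hpos (by positivity)) (hc _)]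
  have hsum : ∀ n, ∑ d ∈ Finset.range n, (1 - r) * r ^ d * c (j + d) =
      y j - (r ^ j)⁻¹ * (r ^ (n + j) * y (n + j)) := fun n => by
    induction n with
    | zero => rw [Finset.sum_range_zero, zero_add, inv_mul_cancel_left₀ (by positivity), sub_self]
    | succ n ih =>
      rw [Finset.sum_range_succ, ih,
        show (1 - r) * r ^ n * c (j + n) = r ^ n * ((1 - r) * c (j + n)) by ring, h,
        show n + 1 + j = j + n + 1 by ring, add_comm n j, pow_succ, pow_add]
      field_simp
      ring
  simp only [hsum]
  simpa using tendsto_const_nhds.sub (((tendsto_add_atTop_iff_nat j).2 hlim).const_mul (r ^ j)⁻¹)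

section

variable {X : Type*} [MeasurableSpace X] {μ : Measure X} {T : Set (Set X)}
  {C : Set X → Set (Set X)}

/-- A function on a tree with two regimes: its maximal function is at least `S` times the function
off `K`, and at least `s` times the function on `K`. -/
theorem IsTreeWith.exists_two_phase_function [IsProbabilityMeasure μ] (h : IsTreeWith μ T C)
    {p e S s f : ℝ} (hp : 0 < p) (he0 : 0 < e) (he1 : e < 1) (hS : 1 ≤ S) (hs : 1 ≤ s)
    (hf : 0 < f) (m : ℕ) (ha : layerRatio p s e < 1) :
    ∃ (K : Set X) (φ : X → ℝ), MeasurableSet K ∧ μ.real K = (1 - e) ^ m ∧ (∀ x, 0 ≤ φ x) ∧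
      MemLp φ (ENNReal.ofReal p) μ ∧ ∫ x, φ x ∂μ = f ∧
      ∫ x in Kᶜ, φ x ^ p ∂μ =
        f ^ p * (S ^ p)⁻¹ * (e * ∑ j ∈ Finset.range m, layerRatio p S e ^ j) ∧
      ∫ x in K, φ x ^ p ∂μ = f ^ p * layerRatio p S e ^ m / (s ^ p * ((1 - layerRatio p s e) / e)) ∧
      (∀ᵐ x ∂μ, x ∈ K → ENNReal.ofReal (s * φ x) ≤ treeMaximal μ T φ x) ∧
      ∀ᵐ x ∂μ, x ∈ Kᶜ → ENNReal.ofReal (S * φ x) ≤ treeMaximal μ T φ x := by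
  have hS0 : 0 < S := by linarith
  have hs0 : 0 < s := by linarith
  set r := 1 - e with hr
  have hr0 : 0 < r := by linarith
  have hr1 : r < 1 := by linarith
  have hre : 1 - r = e := by rw [hr]; ring
  set u := (1 - e / S) / r with hu
  set v := (1 - e / s) / r with hv
  have hru : r * u = 1 - e / S := by rw [hu]; field_simp
  have hrv : r * v = 1 - e / s := by rw [hv]; field_simp
  have hu0 : 0 < u := div_pos (by linarith [div_le_self he0.le hS]) hr0
  have hv0 : 0 < v := div_pos (by linarith [div_le_self he0.le hs]) hr0
  have hau : r * u ^ p = layerRatio p S e := (layerRatio_eq he1 hS).symm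
  have hav : r * v ^ p = layerRatio p s e := (layerRatio_eq he1 hs).symm
  -- Averages grow by u up to level m and by v afterwards. The factors u and v solve e·y/S = y -
  -- r·u·y and e·y/s = y - r·v·y, which keeps averages at S, then s, times the values; the natural
  -- subtraction j - m is 0 in the first phase.
  set y : ℕ → ℝ := fun j => f * u ^ min j m * v ^ (j - m) with hy
  set c : ℕ → ℝ := fun j => y j / (if j < m then S else s) with hc
  have hy0 : ∀ j, 0 < y j := fun j => by positivity
  have hc0 : ∀ j, 0 ≤ c j := fun j => div_nonneg (hy0 j).le (by split_ifs <;> linarith)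
  have hyadd : ∀ d, y (d + m) = f * u ^ m * v ^ d := fun d => by simp [hy]
  have hylt : ∀ j, j < m → y j = f * u ^ j := fun j hj => by
    simp [hy, min_eq_left hj.le, Nat.sub_eq_zero_of_le hj.le]
  have hcadd : ∀ d, c (d + m) = f * u ^ m / s * v ^ d := fun d => by
    simp only [hc, hyadd]
    rw [if_neg (by omega)]
    ring
  have hclt : ∀ j, j < m → c j = f / S * u ^ j := fun j hj => by
    simp only [hc, hylt j hj]
    rw [if_pos hj]
    ring
  have hrec : ∀ j, (1 - r) * c j = y j - r * y (j + 1) := fun j => by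
    by_cases hj : j < m
    · have h1 : y (j + 1) = f * u ^ (j + 1) := by
        simp [hy, min_eq_left (show j + 1 ≤ m from hj), Nat.sub_eq_zero_of_le (show j + 1 ≤ m from hj)]
      rw [hclt j hj, hylt j hj, h1, hre,
        show r * (f * u ^ (j + 1)) = f * u ^ j * (r * u) by ring, hru]
      ring
    · obtain ⟨d, rfl⟩ := Nat.exists_eq_add_of_le' (not_lt.1 hj)
      rw [hcadd, hyadd, show d + m + 1 = d + 1 + m by ring, hyadd, hre,
        show r * (f * u ^ m * v ^ (d + 1)) = f * u ^ m * v ^ d * (r * v) by ring, hrv]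
      ring
  have hlim : Tendsto (fun n => r ^ n * y n) atTop (𝓝 0) := by
    rw [← tendsto_add_atTop_iff_nat m]
    have he : ∀ d, r ^ (d + m) * y (d + m) = r ^ m * (f * u ^ m) * (r * v) ^ d := fun d => by
      rw [hyadd, pow_add, mul_pow]; ring
    simp only [he]
    have h1 : r * v < 1 := by
      rw [hrv]
      have : 0 < e / s := by positivity
      linarith
    simpa using (tendsto_pow_atTop_nhds_zero_of_lt_one (by positivity) h1).const_mul
      (r ^ m * (f * u ^ m))
  have hpow : ∀ x : ℝ, 0 ≤ x → ∀ d : ℕ, (x ^ d) ^ p = (x ^ p) ^ d := fun x hx d => by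
    rw [← Real.rpow_natCast, ← Real.rpow_mul hx, mul_comm, Real.rpow_mul hx, Real.rpow_natCast]
  have htail : HasSum (fun d => (1 - r) * r ^ d * c (m + d) ^ p)
      (e * (f * u ^ m / s) ^ p * (1 - layerRatio p s e)⁻¹) := by
    have h1 := (hasSum_geometric_of_lt_one (layerRatio_pos (p := p) he0.le he1 hs).le ha).mul_left
      (e * (f * u ^ m / s) ^ p)
    refine (congrArg (HasSum · _) (funext fun d => ?_)).mp h1
    rw [add_comm m d, hcadd, Real.mul_rpow (by positivity) (by positivity), hpow v hv0.le, hre,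
      ← hav, mul_pow]
    ring
  have htail' : HasSum (fun d => (1 - r) * r ^ (d + m) * c (d + m) ^ p)
      (r ^ m * (e * (f * u ^ m / s) ^ p * (1 - layerRatio p s e)⁻¹)) := by
    refine (congrArg (HasSum · _) (funext fun d => ?_)).mp (htail.mul_left (r ^ m))
    rw [add_comm m d, pow_add]
    ring
  have htot := (hasSum_nat_add_iff (f := fun j => (1 - r) * r ^ j * c j ^ p) m).1 htail'
  obtain ⟨E, φ, hE, hE0, hanti, hEr, hcov, hφ0, hφc, hφp, hφf, hφE, hM⟩ :=
    h.exists_layered_function hp hr0.le hr1 hc0 (hasSum_of_telescoping hr0 hr1.le hc0 hrec hlim)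
      htot.summable
  have hφi : Integrable (fun x => φ x ^ p) μ := integrable_rpow_of_memLp hp hφ0 hφp
  have hcM : ∀ j, ∀ x ∈ E j \ E (j + 1),
      ENNReal.ofReal ((if j < m then S else s) * φ x) ≤ treeMaximal μ T φ x := fun j x hx => by
    have hne : (if j < m then S else s) ≠ 0 := by split_ifs <;> positivity
    rw [hφc j x hx, mul_div_cancel₀ _ hne]
    exact hM j x hx.1
  have hKint := hφE m _ htail
  refine ⟨E m, φ, hE m, hEr m, hφ0, hφp, ?_, ?_, ?_, ?_, ?_⟩
  · rw [hφf]
    simp [hy]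
  · have h1 := integral_add_compl (hE m) hφi
    have h2 := hφE 0 _ (by simpa using htot)
    rw [hE0, Measure.restrict_univ, pow_zero, mul_one] at h2
    rw [h2, hKint] at h1
    have h3 : ∑ j ∈ Finset.range m, (1 - r) * r ^ j * c j ^ p =
        f ^ p * (S ^ p)⁻¹ * (e * ∑ j ∈ Finset.range m, layerRatio p S e ^ j) := by
      rw [Finset.mul_sum, Finset.mul_sum]
      refine Finset.sum_congr rfl fun j hj => ?_
      rw [hclt j (Finset.mem_range.1 hj), Real.mul_rpow (by positivity) (by positivity),
        hpow u hu0.le, Real.div_rpow hf.le hS0.le, hre, ← hau, mul_pow]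
      ring
    rw [← h3]
    linarith
  · rw [hKint, Real.div_rpow (by positivity) hs0.le, Real.mul_rpow hf.le (by positivity),
      hpow u hu0.le, ← hau, mul_pow]
    field_simp
  · filter_upwards [hcov] with x ⟨j, hj⟩ hx
    have hjm : ¬ j < m := fun hjm => hj.2 (hanti hjm hx)
    simpa [hjm] using hcM j x hj
  · filter_upwards [hcov] with x ⟨j, hj⟩ hx
    have hjm : j < m := by
      by_contra hjm
      exact hx (hanti (not_lt.1 hjm) hj.1)
    simpa [hjm] using hcM j x hj

end

/-! ### From lower bounds on the maximal function to the right-hand side. -/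

section

variable {X : Type*} [MeasurableSpace X] {μ : Measure X} {T : Set (Set X)}

theorem rpow_mul_setIntegral_le_of_le_treeMaximal {φ : X → ℝ} {p s : ℝ} {K : Set X} (hp : 0 ≤ p)
    (hs : 0 ≤ s) (hK : MeasurableSet K) (hφ0 : ∀ x, 0 ≤ φ x)
    (hφ : Integrable (fun x => φ x ^ p) μ) (hfin : ∫⁻ x, treeMaximal μ T φ x ^ p ∂μ < ∞)
    (h : ∀ᵐ x ∂μ, x ∈ K → ENNReal.ofReal (s * φ x) ≤ treeMaximal μ T φ x) :
    s ^ p * ∫ x in K, φ x ^ p ∂μ ≤ (∫⁻ x in K, treeMaximal μ T φ x ^ p ∂μ).toReal := by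
  have hKfin : ∫⁻ x in K, treeMaximal μ T φ x ^ p ∂μ ≠ ∞ :=
    ((setLIntegral_le_lintegral _ _).trans_lt hfin).ne
  rw [← ENNReal.ofReal_le_iff_le_toReal hKfin, ← integral_const_mul,
    ofReal_integral_eq_lintegral_ofReal (hφ.integrableOn.const_mul _)
      (Eventually.of_forall fun x => mul_nonneg (Real.rpow_nonneg hs _)
        (Real.rpow_nonneg (hφ0 x) _))]
  refine setLIntegral_mono_ae' hK ?_
  filter_upwards [h] with x hx hxK
  rw [← Real.mul_rpow hs (hφ0 x), ← ENNReal.ofReal_rpow_of_nonneg (mul_nonneg hs (hφ0 x)) hp]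
  exact ENNReal.rpow_le_rpow (hx hxK) hp

/-- For β = S - 1 and γ = S/t - 1 the net coefficients of the integrals of M^p on K and off K are
both nonnegative, so lower bounds for M suffice. The factor s on K is kept apart from the t that
fixes γ, since near-extremal functions match it only approximately. -/
theorem le_sharp_expression {φ : X → ℝ} {p S s t c : ℝ} {K : Set X} (hp : 1 < p)
    (hS : 1 ≤ S) (ht : 1 ≤ t) (hs : 0 ≤ s) (hK : MeasurableSet K)
    (hφ0 : ∀ x, 0 ≤ φ x) (hφ : Integrable (fun x => φ x ^ p) μ)
    (hfin : ∫⁻ x, treeMaximal μ T φ x ^ p ∂μ < ∞)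
    (hMK : ∀ᵐ x ∂μ, x ∈ K → ENNReal.ofReal (s * φ x) ≤ treeMaximal μ T φ x)
    (hMK' : ∀ᵐ x ∂μ, x ∈ Kᶜ → ENNReal.ofReal (S * φ x) ≤ treeMaximal μ T φ x) :
    (1 - (t / S) ^ (p - 1)) * (∫ x in K, φ x ^ p ∂μ) + (p - 1) * (S - 1) * (∫ x in Kᶜ, φ x ^ p ∂μ)
        + (p - 1) * (S - S / t) / S ^ p * (s ^ p * ∫ x in K, φ x ^ p ∂μ) + c / S ^ (p - 1) ≤
      (1 - 1 / (1 + (S / t - 1)) ^ (p - 1)) * (∫ x in K, φ x ^ p ∂μ)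
        + (p - 1) * (S - 1) / (S - 1 + 1) ^ p * (∫⁻ x, treeMaximal μ T φ x ^ p ∂μ).toReal
        - (p - 1) * (S / t - 1) / (S - 1 + 1) ^ p *
          (∫⁻ x in K, treeMaximal μ T φ x ^ p ∂μ).toReal
        + c / (S - 1 + 1) ^ (p - 1) := by
  have hS0 : 0 < S := by linarith
  have ht0 : 0 < t := by linarith
  have hp0 : 0 < p := by linarith
  have h1 := rpow_mul_setIntegral_le_of_le_treeMaximal hp0.le hs hK hφ0 hφ hfin hMK
  have h2 := rpow_mul_setIntegral_le_of_le_treeMaximal hp0.le hS0.le hK.compl hφ0 hφ hfin hMK'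
  rw [← lintegral_add_compl _ hK, ENNReal.toReal_add
    ((setLIntegral_le_lintegral _ _).trans_lt hfin).ne
    ((setLIntegral_le_lintegral _ _).trans_lt hfin).ne]
  set G := (∫⁻ x in K, treeMaximal μ T φ x ^ p ∂μ).toReal
  set G' := (∫⁻ x in Kᶜ, treeMaximal μ T φ x ^ p ∂μ).toReal
  set A := ∫ x in Kᶜ, φ x ^ p ∂μ
  set B := ∫ x in K, φ x ^ p ∂μ
  have e1 : 1 / (1 + (S / t - 1)) ^ (p - 1) = (t / S) ^ (p - 1) := by
    rw [add_sub_cancel, one_div, ← Real.inv_rpow (by positivity), inv_div]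
  rw [e1, sub_add_cancel]
  have hSt : S / t ≤ S := div_le_self hS0.le ht
  have hSp : 0 < S ^ p := by positivity
  have e2 : (p - 1) * (S - 1) * A = (p - 1) * (S - 1) / S ^ p * (S ^ p * A) := by field_simp
  have h3 : (p - 1) * (S - 1) / S ^ p * (S ^ p * A) ≤ (p - 1) * (S - 1) / S ^ p * G' :=
    mul_le_mul_of_nonneg_left h2
      (div_nonneg (mul_nonneg (by linarith) (by linarith)) hSp.le)
  have h4 : (p - 1) * (S - S / t) / S ^ p * (s ^ p * B) ≤ (p - 1) * (S - S / t) / S ^ p * G :=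
    mul_le_mul_of_nonneg_left h1
      (div_nonneg (mul_nonneg (by linarith) (by linarith)) hSp.le)
  have e3 : (p - 1) * (S - S / t) / S ^ p * G = (p - 1) * (S - 1) / S ^ p * G -
      (p - 1) * (S / t - 1) / S ^ p * G := by ring
  rw [e2]
  rw [e3] at h4
  linarith

end

/-! ### Limits for thin layers and the choice of parameters. -/

/-- The exponential rate of the layer ratio. -/
noncomputable def layerRate (p τ : ℝ) : ℝ := 1 - p * (1 - 1 / τ)

/-- The reciprocal of the extremal quotient of `p`-th powers for the ratio `τ` between the maximal
function and the function. -/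
noncomputable def layerProfile (p τ : ℝ) : ℝ := τ ^ p * layerRate p τ

theorem hasDerivAt_layerRatio (p τ : ℝ) : HasDerivAt (layerRatio p τ) (-layerRate p τ) 0 := by
  have h1 : HasDerivAt (fun e : ℝ => 1 - e / τ) (-(1 / τ)) 0 :=
    ((hasDerivAt_id (0 : ℝ)).div_const τ).const_sub 1
  have h2 : HasDerivAt (fun e : ℝ => 1 - e) (-1) 0 := (hasDerivAt_id (0 : ℝ)).const_sub 1
  have h3 := (h1.rpow_const (p := p) (Or.inl (by simp))).mul
    (h2.rpow_const (p := 1 - p) (Or.inl (by simp)))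
  refine HasDerivAt.congr_deriv (f := layerRatio p τ) h3 ?_
  simp [layerRate]
  ring

theorem layerRatio_zero (p τ : ℝ) : layerRatio p τ 0 = 1 := by simp [layerRatio]

theorem tendsto_one_sub_layerRatio_div (p τ : ℝ) {e : ℕ → ℝ} (he : Tendsto e atTop (𝓝[≠] 0)) :
    Tendsto (fun n => (1 - layerRatio p τ (e n)) / e n) atTop (𝓝 (layerRate p τ)) := by
  have h := ((hasDerivAt_layerRatio p τ).tendsto_slope_zero.comp he).neg
  rw [neg_neg] at h
  refine h.congr fun n => ?_
  simp only [Function.comp_apply, zero_add, layerRatio_zero, smul_eq_mul]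
  ring

/-- The logarithm of the power is (m e) · (log g(e) / e), and log g has slope d at 0. Used for the
measure of K and for the p-th powers on it. -/
theorem HasDerivAt.tendsto_pow_exp {g : ℝ → ℝ} {d l : ℝ} (hg : HasDerivAt g d 0) (hg0 : g 0 = 1)
    {e : ℕ → ℝ} {m : ℕ → ℕ} (he : Tendsto e atTop (𝓝[≠] 0))
    (hm : Tendsto (fun n => m n * e n) atTop (𝓝 l)) :
    Tendsto (fun n => g (e n) ^ m n) atTop (𝓝 (Real.exp (l * d))) := by
  have hlog : HasDerivAt (fun x => Real.log (g x)) d 0 := by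
    simpa [hg0] using hg.log (by simp [hg0])
  have h1 := hlog.tendsto_slope_zero.comp he
  have h2 := (Real.continuous_exp.tendsto _).comp (hm.mul h1)
  have hpos : ∀ᶠ n in atTop, 0 < g (e n) := by
    have : Tendsto (fun n => g (e n)) atTop (𝓝 1) := by
      have := hg.continuousAt.tendsto.comp (he.mono_right nhdsWithin_le_nhds)
      rwa [hg0] at this
    exact this.eventually_const_lt one_pos
  have hne : ∀ᶠ n in atTop, e n ≠ 0 := he.eventually (eventually_mem_nhdsWithin)
  refine h2.congr' ?_
  filter_upwards [hpos, hne] with n hn hn'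
  simp only [Function.comp_apply, zero_add, hg0, Real.log_one, sub_zero, smul_eq_mul]
  rw [mul_assoc, mul_inv_cancel_left₀ hn', mul_comm, Real.exp_mul, Real.exp_log hn,
    Real.rpow_natCast]

theorem layerProfile_one (p : ℝ) : layerProfile p 1 = 1 := by simp [layerProfile, layerRate]

theorem layerProfile_eq {p τ : ℝ} (hτ : 0 < τ) :
    layerProfile p τ = p * τ ^ (p - 1) - (p - 1) * τ ^ p := by
  rw [layerProfile, layerRate, Real.rpow_sub_one hτ.ne']
  field_simp
  ring

theorem continuousOn_layerRate (p : ℝ) : ContinuousOn (layerRate p) (Set.Ioi 0) := by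
  unfold layerRate
  have : ContinuousOn (fun τ : ℝ => 1 / τ) (Set.Ioi 0) :=
    continuousOn_const.div continuousOn_id fun _ hx => ne_of_gt hx
  fun_prop

theorem continuousOn_layerProfile (p : ℝ) : ContinuousOn (layerProfile p) (Set.Ioi 0) :=
  (continuousOn_id.rpow_const fun _ hx => Or.inl (ne_of_gt hx)).mul (continuousOn_layerRate p)

/-- The derivative is -p(p-1)τ^(p-2)(τ-1). Strict monotonicity is what lets the factors be tuned by
intermediate values. -/
theorem strictAntiOn_layerProfile {p : ℝ} (hp : 1 < p) :
    StrictAntiOn (layerProfile p) (Set.Ici 1) := by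
  refine strictAntiOn_of_deriv_neg (convex_Ici 1)
    ((continuousOn_layerProfile p).mono fun x hx => one_pos.trans_le (Set.mem_Ici.1 hx)) fun x hx => ?_
  rw [interior_Ici] at hx
  have hx1 : 1 < x := hx
  have hx0 : 0 < x := by linarith
  have h1 : HasDerivAt (fun τ : ℝ => p * τ ^ (p - 1) - (p - 1) * τ ^ p)
      (p * ((p - 1) * x ^ (p - 1 - 1)) - (p - 1) * (p * x ^ (p - 1))) x :=
    ((Real.hasDerivAt_rpow_const (Or.inl hx0.ne')).const_mul p).sub
      ((Real.hasDerivAt_rpow_const (Or.inl hx0.ne')).const_mul (p - 1))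
  have h2 : layerProfile p =ᶠ[𝓝 x] fun τ => p * τ ^ (p - 1) - (p - 1) * τ ^ p := by
    filter_upwards [lt_mem_nhds hx0] with τ hτ
    exact layerProfile_eq hτ
  rw [h2.deriv_eq, h1.deriv, Real.rpow_sub_one hx0.ne' (p - 1)]
  have h3 : p * ((p - 1) * (x ^ (p - 1) / x)) - (p - 1) * (p * x ^ (p - 1)) =
      -(p * (p - 1) * x ^ (p - 1) * ((x - 1) / x)) := by
    field_simp
    ring
  rw [h3, neg_lt_zero]
  have : 0 < (x - 1) / x := div_pos (by linarith) hx0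
  have : 0 < p - 1 := by linarith
  positivity

/-- Existence of parameters for which the extremal quotient of the two-phase functions equals a
given number `V > 1`. -/
theorem exists_phase_parameters {p V l : ℝ} (hp : 1 < p) (hV : 1 < V) :
    ∃ S s : ℝ, 1 < s ∧ s < S ∧ 0 < layerRate p S ∧ 0 < layerRate p s ∧
      (1 - Real.exp (l * -layerRate p S)) / layerProfile p S +
        Real.exp (l * -layerRate p S) / layerProfile p s = V := by
  have hp1 : 0 < p - 1 := by linarith
  have hV0 : 0 < V := by linarith
  -- The zero of `layerRate`; rate and profile are positive on [1, q).
  set q := p / (p - 1) with hq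
  have hq1 : 1 < q := by rw [hq, one_lt_div hp1]; linarith
  have hrate : ∀ τ, 1 ≤ τ → τ < q → 0 < layerRate p τ := fun τ h1 h2 => by
    have hτ : 0 < τ := by linarith
    rw [hq, lt_div_iff₀ hp1] at h2
    have : layerRate p τ = (τ - p * (τ - 1)) / τ := by rw [layerRate]; field_simp
    rw [this]
    exact div_pos (by linarith) hτ
  have hprof : ∀ τ, 1 ≤ τ → τ < q → 0 < layerProfile p τ := fun τ h1 h2 =>
    mul_pos (Real.rpow_pos_of_pos (by linarith) _) (hrate τ h1 h2)
  have hprofq : layerProfile p q = 0 := by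
    rw [layerProfile, layerRate, hq]
    have : p ≠ 0 := by linarith
    field_simp
    simp
  have hV1 : V⁻¹ < 1 := inv_lt_one_of_one_lt₀ hV
  -- S₀ is the solution with one phase, s = S. With s = 1 instead, the quotient at S₀ drops below V.
  obtain ⟨S₀, ⟨hS₀1, hS₀q⟩, hS₀⟩ := intermediate_value_Ioo' hq1.le
    ((continuousOn_layerProfile p).mono fun x hx => one_pos.trans_le hx.1)
    (show V⁻¹ ∈ Set.Ioo (layerProfile p q) (layerProfile p 1) by
      rw [hprofq, layerProfile_one]
      exact ⟨by positivity, hV1⟩)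
  have hS₀pos : 0 < S₀ := by linarith
  have hcrate : ContinuousAt (layerRate p) S₀ :=
    (continuousOn_layerRate p).continuousAt (Ioi_mem_nhds hS₀pos)
  have hcprof : ContinuousAt (layerProfile p) S₀ :=
    (continuousOn_layerProfile p).continuousAt (Ioi_mem_nhds hS₀pos)
  have hcw : ContinuousAt (fun τ => Real.exp (l * -layerRate p τ)) S₀ :=
    Real.continuous_exp.continuousAt.comp (hcrate.neg.const_mul l)
  have hcont : ContinuousAt (fun τ => (1 - Real.exp (l * -layerRate p τ)) / layerProfile p τ +
      Real.exp (l * -layerRate p τ)) S₀ :=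
    ((continuousAt_const.sub hcw).div hcprof (hprof S₀ hS₀1.le hS₀q).ne').add hcw
  have hlt : (1 - Real.exp (l * -layerRate p S₀)) / layerProfile p S₀ +
      Real.exp (l * -layerRate p S₀) < V := by
    rw [hS₀, div_inv_eq_mul]
    have := mul_pos (Real.exp_pos (l * -layerRate p S₀)) (sub_pos.2 hV)
    linarith
  -- For S slightly above S₀ the quotient is still below V at s = 1, but equals 1 / `layerProfile p
  -- S` > V at s = S, so V is attained strictly in between.
  obtain ⟨S, ⟨hSV, hSq⟩, hS⟩ : ∃ S, ((1 - Real.exp (l * -layerRate p S)) / layerProfile p S +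
      Real.exp (l * -layerRate p S) < V ∧ S < q) ∧ S₀ < S :=
    ((((hcont.eventually_lt_const hlt).and (gt_mem_nhds hS₀q)).filter_mono
      nhdsWithin_le_nhds).and (self_mem_nhdsWithin (s := Set.Ioi S₀))).exists
  have hS1 : 1 < S := hS₀1.trans hS
  have hpS := hprof S hS1.le hSq
  set w := Real.exp (l * -layerRate p S) with hw
  have hcg : ContinuousOn (fun τ => (1 - w) / layerProfile p S + w / layerProfile p τ)
      (Set.Icc 1 S) :=
    continuousOn_const.add (continuousOn_const.div
      ((continuousOn_layerProfile p).mono fun x hx => one_pos.trans_le hx.1)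
      fun x hx => (hprof x hx.1 (hx.2.trans_lt hSq)).ne')
  obtain ⟨s, ⟨hs1, hsS⟩, hs⟩ := intermediate_value_Ioo hS1.le hcg
    (show V ∈ Set.Ioo _ _ by
      simp only [layerProfile_one, div_one]
      refine ⟨hSV, ?_⟩
      rw [← add_div, sub_add_cancel, lt_div_iff₀ hpS, mul_comm, ← lt_div_iff₀ hV0, one_div, ← hS₀]
      exact strictAntiOn_layerProfile hp hS₀1.le hS1.le hS)
  exact ⟨S, s, hs1, hsS, hrate S hS1.le hSq, hrate s hs1.le (hsS.trans hSq), hs⟩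

/-- The identity behind the sharpness of the inequality. -/
theorem sharp_identity {p S s w c : ℝ} (hS : 0 < S) (hs : 0 < s)
    (hSr : layerRate p S ≠ 0) (hsr : layerRate p s ≠ 0) :
    (1 - (s / S) ^ (p - 1)) * (c * w / layerProfile p s)
        + (p - 1) * (S - 1) * (c * ((1 - w) / layerProfile p S))
        + (p - 1) * (S - S / s) / S ^ p * (s ^ p * (c * w / layerProfile p s)) + c / S ^ (p - 1) =
      c * ((1 - w) / layerProfile p S + w / layerProfile p s) := by
  rw [Real.div_rpow hs.le hS.le, Real.rpow_sub_one hs.ne', Real.rpow_sub_one hS.ne',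
    layerProfile, layerProfile]
  have ha : 0 < S ^ p := by positivity
  have hb : 0 < s ^ p := by positivity
  set a := S ^ p
  set b := s ^ p
  have eS : layerRate p S = (S - p * (S - 1)) / S := by rw [layerRate]; field_simp
  have es : layerRate p s = (s - p * (s - 1)) / s := by rw [layerRate]; field_simp
  have hPS : S - p * (S - 1) ≠ 0 := fun h0 => hSr (by rw [eS, h0, zero_div])
  have hPs : s - p * (s - 1) ≠ 0 := fun h0 => hsr (by rw [es, h0, zero_div])
  rw [eS, es]
  field_simp
  ring

/-! ### Near-extremal functions and the conclusion. -/

/-- Near-extremal functions for the sharp inequality, with a nontrivial weight on `K`. -/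
theorem IsTreeWith.exists_near_extremal {X : Type*} [MeasurableSpace X] {μ : Measure X}
    [IsProbabilityMeasure μ] {T : Set (Set X)} {C : Set X → Set (Set X)} (h : IsTreeWith μ T C)
    {p f F k : ℝ} (hp : 1 < p) (hf : 0 < f) (hF : f ^ p < F) (hk : k ∈ Set.Ioc (0 : ℝ) 1) :
    ∃ β γ : ℝ, 0 < γ ∧ γ ≤ β ∧ ∀ ε > 0, ∃ (K : Set X) (φ : X → ℝ), MeasurableSet K ∧
      |μ.real K - k| < ε ∧ MemLp φ (ENNReal.ofReal p) μ ∧ (∀ x, 0 ≤ φ x) ∧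
      ∫ x, φ x ∂μ = f ∧ ∫ x, φ x ^ p ∂μ = F ∧
      F - ε < (1 - 1 / (1 + γ) ^ (p - 1)) * (∫ x in K, φ x ^ p ∂μ)
          + (p - 1) * β / (β + 1) ^ p * (∫⁻ x, treeMaximal μ T φ x ^ p ∂μ).toReal
          - (p - 1) * γ / (β + 1) ^ p * (∫⁻ x in K, treeMaximal μ T φ x ^ p ∂μ).toReal
          + f ^ p / (β + 1) ^ (p - 1) := by
  have hp0 : 0 < p := by linarith
  set c := f ^ p with hc
  have hc0 : 0 < c := by positivity
  set l := -Real.log k with hl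
  have hl0 : 0 ≤ l := neg_nonneg.2 (Real.log_nonpos hk.1.le hk.2)
  obtain ⟨S, s, hs1, hsS, hrS, hrs, hV⟩ := exists_phase_parameters (V := F / c) (l := l) hp
    ((one_lt_div hc0).2 hF)
  have hS1 : 1 < S := hs1.trans hsS
  have hS0 : 0 < S := by linarith
  have hs0 : 0 < s := by linarith
  set w := Real.exp (l * -layerRate p S) with hw
  have hw0 : 0 < w := Real.exp_pos _
  have hhS : 0 < layerProfile p S := mul_pos (by positivity) hrS
  have hhs : 0 < layerProfile p s := mul_pos (by positivity) hrs
  have hFV : c * ((1 - w) / layerProfile p S + w / layerProfile p s) = F := by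
    rw [hV]; field_simp
  -- The Young parameters β + 1 and (β+1)/(1+γ) become S and s.
  refine ⟨S - 1, S / s - 1, sub_pos.2 ((one_lt_div hs0).2 hsS),
    sub_le_sub_right (div_le_self hS0.le hs1.le) 1, fun ε hε => ?_⟩
  -- The shift by 2 keeps e below 1 at n = 0. With m the integer part of l/e, (1 - e)^m tends to
  -- exp(-l) = k.
  set e : ℕ → ℝ := fun n => 1 / ((n : ℝ) + 2) with he
  set m : ℕ → ℕ := fun n => ⌊l * ((n : ℝ) + 2)⌋₊ with hm
  have htop : Tendsto (fun n : ℕ => (n : ℝ) + 2) atTop atTop :=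
    tendsto_atTop_add_const_right _ _ tendsto_natCast_atTop_atTop
  have he0 : ∀ n, 0 < e n := fun n => by positivity
  have he1 : ∀ n, e n < 1 := fun n => by
    rw [he, div_lt_one (by positivity)]
    have : (0 : ℝ) ≤ n := n.cast_nonneg
    linarith
  have helim : Tendsto e atTop (𝓝[≠] 0) := by
    refine tendsto_nhdsWithin_iff.2 ⟨?_, Eventually.of_forall fun n => (he0 n).ne'⟩
    simpa [he, Function.comp_def] using tendsto_inv_atTop_zero.comp htop
  have hmlim : Tendsto (fun n => m n * e n) atTop (𝓝 l) := by
    refine ((tendsto_nat_floor_mul_div_atTop hl0).comp htop).congr fun n => ?_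
    simp [hm, he, div_eq_mul_inv]
  set P : ℕ → ℝ := fun n => layerRatio p S (e n) ^ m n with hP
  have hP0 : ∀ n, 0 < P n := fun n => pow_pos (layerRatio_pos (he0 n).le (he1 n) hS1.le) _
  have hPlim : Tendsto P atTop (𝓝 w) :=
    (hasDerivAt_layerRatio p S).tendsto_pow_exp (layerRatio_zero p S) helim hmlim
  have hKlim : Tendsto (fun n => (1 - e n) ^ m n) atTop (𝓝 k) := by
    have := ((hasDerivAt_id (0 : ℝ)).const_sub 1).tendsto_pow_exp (by simp) helim hmlim
    rw [hl, mul_neg_one, neg_neg, Real.exp_log hk.1] at this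
    exact this
  -- The integral of φ^p off K. It does not depend on the factor used on K, which is therefore free
  -- to make the integral over K equal to F - A n.
  set A : ℕ → ℝ := fun n =>
    c * (S ^ p)⁻¹ * (e n * ∑ j ∈ Finset.range (m n), layerRatio p S (e n) ^ j) with hA
  have hAlim : Tendsto A atTop (𝓝 (c * ((1 - w) / layerProfile p S))) := by
    have h1 := tendsto_one_sub_layerRatio_div p S helim
    have h2 := ((hPlim.const_sub 1).div h1 hrS.ne').const_mul (c * (S ^ p)⁻¹)
    have h3 : c * (S ^ p)⁻¹ * ((1 - w) / layerRate p S) = c * ((1 - w) / layerProfile p S) := by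
      rw [layerProfile]
      field_simp
    rw [h3] at h2
    refine h2.congr' ?_
    filter_upwards [h1.eventually_const_lt hrS] with n hn
    have hne : layerRatio p S (e n) ≠ 1 := fun h0 => by simp [h0] at hn
    have hne' : 1 - layerRatio p S (e n) ≠ 0 := sub_ne_zero.2 hne.symm
    have hne'' : layerRatio p S (e n) - 1 ≠ 0 := sub_ne_zero.2 hne
    have := (he0 n).ne'
    simp only [hA, hP, Pi.div_apply]
    rw [geom_sum_eq hne, ← neg_sub (1 : ℝ) (layerRatio p S (e n)),
      ← neg_sub (1 : ℝ) (layerRatio p S (e n) ^ m n), neg_div_neg_eq]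
    field_simp
  have hBeq : F - c * ((1 - w) / layerProfile p S) = c * w / layerProfile p s := by
    rw [← hFV]; ring
  have hB0 : 0 < c * w / layerProfile p s := by positivity
  have hBlim : Tendsto (fun n => F - A n) atTop (𝓝 (c * w / layerProfile p s)) := by
    rw [← hBeq]
    exact hAlim.const_sub F
  have hHlim : Tendsto (fun n => c * P n / (F - A n)) atTop (𝓝 (layerProfile p s)) := by
    have := (hPlim.const_mul c).div hBlim hB0.ne'
    rwa [div_div_cancel₀ (by positivity)] at this
  have hid := sharp_identity (p := p) (w := w) (c := c) hS0 hs0 hrS.ne' hrs.ne'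
  rw [hFV] at hid
  -- At τ = s the expression equals F by `sharp_identity`, so by continuity some smaller factor τ on
  -- K costs less than ε.
  obtain ⟨τ, ⟨hτε, hτ1⟩, hτs⟩ : ∃ τ, (F - ε < (1 - (s / S) ^ (p - 1)) * (c * w / layerProfile p s)
      + (p - 1) * (S - 1) * (c * ((1 - w) / layerProfile p S))
      + (p - 1) * (S - S / s) / S ^ p * (τ ^ p * (c * w / layerProfile p s)) + c / S ^ (p - 1) ∧
      1 < τ) ∧ τ < s := by
    have hcont : ContinuousAt (fun τ => (1 - (s / S) ^ (p - 1)) * (c * w / layerProfile p s)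
      + (p - 1) * (S - 1) * (c * ((1 - w) / layerProfile p S))
      + (p - 1) * (S - S / s) / S ^ p * (τ ^ p * (c * w / layerProfile p s))
      + c / S ^ (p - 1)) s :=
      (continuousAt_const.add (continuousAt_const.mul
        ((continuousAt_id.rpow_const (Or.inl hs0.ne')).mul continuousAt_const))).add
        continuousAt_const
    exact ((((hcont.eventually_const_lt (by simp only [hid]; linarith)).and
      (lt_mem_nhds hs1)).filter_mono nhdsWithin_le_nhds).and
      (self_mem_nhdsWithin (s := Set.Iio s))).exists
  have hanti := strictAntiOn_layerProfile hp
  have hGlim : ∀ t : ℝ, Tendsto (fun n => t ^ p * ((1 - layerRatio p t (e n)) / e n)) atTop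
      (𝓝 (layerProfile p t)) := fun t => (tendsto_one_sub_layerRatio_div p t helim).const_mul _
  have hlow := hHlim.eventually_lt (hGlim τ) (hanti hτ1.le hs1.le hτs)
  have hup := (hGlim (s + 1)).eventually_lt hHlim
    (hanti hs1.le (by simp only [Set.mem_Ici]; linarith) (lt_add_one s))
  have hLBlim := ((((hBlim.const_mul (1 - (s / S) ^ (p - 1))).add
    (hAlim.const_mul ((p - 1) * (S - 1)))).add
    ((hBlim.const_mul (τ ^ p)).const_mul ((p - 1) * (S - S / s) / S ^ p))).add_const
    (c / S ^ (p - 1))).eventually_const_lt hτε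
  have hKev : ∀ᶠ n in atTop, |(1 - e n) ^ m n - k| < ε := by
    have := (hKlim.sub_const k).abs.eventually_lt_const (u := ε) (by simpa)
    exact this
  obtain ⟨n, hn1, hn2, hn3, hn4, hn5⟩ := (hlow.and (hup.and (hLBlim.and
    (hKev.and (hBlim.eventually_const_lt hB0))))).exists
  have hcontG : ContinuousOn (fun t => t ^ p * ((1 - layerRatio p t (e n)) / e n))
      (Set.Icc τ (s + 1)) := by
    have hpos : ∀ t ∈ Set.Icc τ (s + 1), t ≠ 0 := fun t ht => by linarith [ht.1]
    have h1 : ContinuousOn (fun t => layerRatio p t (e n)) (Set.Icc τ (s + 1)) :=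
      ((continuousOn_const.sub (continuousOn_const.div continuousOn_id hpos)).rpow_const
        fun _ _ => Or.inr hp0.le).mul continuousOn_const
    exact (continuousOn_id.rpow_const fun t ht => Or.inl (hpos t ht)).mul
      ((continuousOn_const.sub h1).div_const _)
  -- For large n the required value lies between those at s + 1 and τ, because the limits are
  -- ordered by the strictly decreasing profile. The resulting t gives ∫φ^p = F exactly, and t ≥ τ
  -- secures the lower bound.
  obtain ⟨t, ⟨htτ, -⟩, ht⟩ := intermediate_value_Icc' (by linarith) hcontG ⟨hn2.le, hn1.le⟩
  have ht1 : 1 < t := hτ1.trans_le htτ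
  have hH0 : 0 < c * P n / (F - A n) := div_pos (mul_pos hc0 (hP0 n)) hn5
  have hratio : layerRatio p t (e n) < 1 := by
    have h1 : 0 < t ^ p * ((1 - layerRatio p t (e n)) / e n) := by
      simp only at ht
      rwa [ht]
    have h2 := (pos_iff_pos_of_mul_pos h1).1 (by positivity)
    linarith [(div_pos_iff_of_pos_right (he0 n)).1 h2]
  obtain ⟨K, φ, hK, hKm, hφ0, hφp, hφf, hφK', hφK, hMK, hMK'⟩ :=
    h.exists_two_phase_function hp0 (he0 n) (he1 n) hS1.le ht1.le hf (m n) hratio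
  have hφi := integrable_rpow_of_memLp hp0 hφ0 hφp
  have hφK1 : ∫ x in Kᶜ, φ x ^ p ∂μ = A n := hφK'
  have hφK2 : ∫ x in K, φ x ^ p ∂μ = F - A n := by
    simp only at ht
    rw [hφK, ht]
    exact div_div_cancel₀ (mul_pos hc0 (hP0 n)).ne'
  refine ⟨K, φ, hK, by rwa [hKm], hφp, hφ0, hφf, ?_, ?_⟩
  · rw [← integral_add_compl hK hφi, hφK1, hφK2]
    ring
  · have hfin := (lintegral_treeMaximal_rpow_lt_top_and_sharp_inequality h hp hφp
      (Eventually.of_forall hφ0)).1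
    have hle := le_sharp_expression (c := c) hp hS1.le hs1.le (by linarith : 0 ≤ t) hK hφ0 hφi
      hfin hMK hMK'
    refine lt_of_lt_of_le (hn3.trans_le ?_) hle
    rw [hφK1, hφK2]
    have hcoef : 0 ≤ (p - 1) * (S - S / s) / S ^ p :=
      div_nonneg (mul_nonneg (by linarith) (sub_nonneg.2 (div_le_self hS0.le hs1.le)))
        (by positivity)
    have hpow : τ ^ p ≤ t ^ p := Real.rpow_le_rpow (by linarith) htτ hp0.le
    gcongr

theorem theorem1p3 {X : Type*} [MeasurableSpace X] (μ : Measure X) [IsProbabilityMeasure μ]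
    (hμ : IsNonatomic μ) (T : Set (Set X)) (hT : IsTree μ T) (p : ℝ) (hp : 1 < p) :
    -- the inequality
    (∀ β γ : ℝ, 0 ≤ γ → γ ≤ β →
      ∀ k ∈ Set.Ioc (0 : ℝ) 1, ∀ K : Set X, MeasurableSet K → μ.real K = k →
      ∀ (f F : ℝ) (φ : X → ℝ), MemLp φ (ENNReal.ofReal p) μ → 0 ≤ᵐ[μ] φ →
        ∫ x, φ x ∂μ = f → ∫ x, φ x ^ p ∂μ = F →
        ∫⁻ x, treeMaximal μ T φ x ^ p ∂μ < ∞ ∧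
        F ≥ (1 - 1 / (1 + γ) ^ (p - 1)) * (∫ x in K, φ x ^ p ∂μ)
          + (p - 1) * β / (β + 1) ^ p * (∫⁻ x, treeMaximal μ T φ x ^ p ∂μ).toReal
          - (p - 1) * γ / (β + 1) ^ p * (∫⁻ x in K, treeMaximal μ T φ x ^ p ∂μ).toReal
          + f ^ p / (β + 1) ^ (p - 1)) ∧
    -- its sharpness
    (∀ f F : ℝ, 0 < f → f ^ p ≤ F → ∀ k ∈ Set.Ioc (0 : ℝ) 1,
      ∃ β γ : ℝ, 0 ≤ γ ∧ γ ≤ β ∧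
      ∃ (K : ℕ → Set X) (φ : ℕ → X → ℝ),
        (∀ n, MeasurableSet (K n)) ∧
        Tendsto (fun n => μ.real (K n)) atTop (𝓝 k) ∧
        (∀ n, MemLp (φ n) (ENNReal.ofReal p) μ ∧ (∀ x, 0 ≤ φ n x) ∧
          ∫ x, φ n x ∂μ = f ∧ ∫ x, φ n x ^ p ∂μ = F) ∧
        Tendsto (fun n =>
          (1 - 1 / (1 + γ) ^ (p - 1)) * (∫ x in K n, φ n x ^ p ∂μ)
          + (p - 1) * β / (β + 1) ^ p * (∫⁻ x, treeMaximal μ T (φ n) x ^ p ∂μ).toReal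
          - (p - 1) * γ / (β + 1) ^ p * (∫⁻ x in K n, treeMaximal μ T (φ n) x ^ p ∂μ).toReal
          + f ^ p / (β + 1) ^ (p - 1)) atTop (𝓝 F)) := by
  obtain ⟨C, h⟩ := hT
  constructor
  · rintro β γ hγ hγβ k - K hK - f F φ hφ hφ0 rfl rfl
    obtain ⟨h1, h2⟩ := lintegral_treeMaximal_rpow_lt_top_and_sharp_inequality h hp hφ hφ0
    exact ⟨h1, h2 β γ (hγ.trans hγβ) hγ K hK⟩
  · intro f F hf hfF k hk
    rcases hfF.eq_or_lt with rfl | hF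
    -- When F = f^p, the constant function with β = γ = 0 gives equality: only the term f^p survives
    -- on the right.
    · obtain ⟨S, hST, -, -, hS⟩ := h.exists_subfamily h.univ_mem hk.1.le (by simpa using hk.2)
      refine ⟨0, 0, le_rfl, le_rfl, fun _ => ⋃₀ S, fun _ _ => f, fun _ => ?_, ?_, fun _ => ?_, ?_⟩
      · exact MeasurableSet.sUnion (h.countable.mono hST) fun I hI => h.measurableSet I (hST hI)
      · simp only [hS]
        exact tendsto_const_nhds
      · exact ⟨memLp_const f, fun _ => hf.le, by simp, by simp⟩
      · simp
    · obtain ⟨β, γ, hγ, hγβ, hex⟩ := h.exists_near_extremal hp hf hF hk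
      choose K φ hK hKk hφ hφ0 hφf hφF hlow using
        fun n : ℕ => hex (1 / ((n : ℝ) + 1)) Nat.one_div_pos_of_nat
      have hlim := tendsto_one_div_add_atTop_nhds_zero_nat (𝕜 := ℝ)
      refine ⟨β, γ, hγ.le, hγβ, K, φ, hK, ?_, fun n => ⟨hφ n, hφ0 n, hφf n, hφF n⟩, ?_⟩
      · rw [tendsto_iff_dist_tendsto_zero]
        exact squeeze_zero (fun n => dist_nonneg) (fun n => (hKk n).le) hlim
      -- The upper bound F in the squeeze is the inequality already proved.
      · refine tendsto_of_tendsto_of_tendsto_of_le_of_le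
          (g := fun n : ℕ => F - 1 / ((n : ℝ) + 1)) (h := fun _ => F)
          (by simpa using hlim.const_sub F) tendsto_const_nhds (fun n => (hlow n).le) fun n => ?_
        have := (lintegral_treeMaximal_rpow_lt_top_and_sharp_inequality h hp (hφ n)
          (Eventually.of_forall (hφ0 n))).2 β γ (hγ.le.trans hγβ) hγ.le (K n) (hK n)
        rwa [hφf, hφF] at this
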